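/- Let $q\ge 2$ be an integer and let $\mathfrak X$ be the homogeneous tree of degree $q+1$, i.e. a tree in which every vertex has exactly $q+1$ neighbours, with graph distance $d$. Fix a vertex $o$ and put $|x|=d(o,x)$. A function $f$ on $\mathfrak X$ is radial if $f(x)$ depends only on $|x|$. Put $\tau=2\pi/\log q$, and let $\mathcal Lf(x)=f(x)-\frac1{q+1}\sum_{d(x,y)=1}f(y)$ be the Laplacian. For $z\in\mathbb C$ let $$\gamma(z)=1-\frac{q^{1/2+iz}+q^{1/2-iz}}{q+1},$$ and let $\phi_z$ be the elementary spherical function, i.e. the unique radial function with $\mathcal L\phi_z=\gamma(z)\phi_z$ and $\phi_z(o)=1$. For $1<p\le 2$ let $\mathcal S_p(\mathfrak X)^{\#}$ be the space of radial functions $f:\mathfrak X\to\mathbb C$ such that $$\nu_m(f)=\sup_{x\in\mathfrak X}(1+|x|)^m q^{|x|/p}|f(x)|<\infty\qquad\text{for all integers } m\ge 0,$$ with the topology defined by the seminorms $\nu_m$. Let $\delta_p=\frac1p-\frac12$ and $S_p=\{z\in\mathbb C: |\Im z|\le|\delta_p|\}$ (so $S_2=\mathbb R$). Let $\mathcal H(S_p)^{\#}$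 be the space of even, $\tau$-periodic functions $g:S_p\to\mathbb C$ that are continuous on $S_p$, holomorphic in the interior of $S_p$, and have derivatives of all orders on $S_p$ (taken within $S_p$ at boundary points, and with respect to the real variable if $p=2$) with $$\mu_m(g)=\sup_{z\in S_p}\left|g^{(m)}(z)\right|<\infty\qquad\text{for all integers } m\ge 0,$$ with the topology defined by the seminorms $\mu_m$. **Theorem 5.1.** Let $1<p\le 2$. For every $f\in\mathcal S_p(\mathfrak X)^{\#}$ and every $z\in S_p$ the series $$\hat f(z)=\sum_{x\in\mathfrak X}f(x)\phi_z(x)$$ converges absolutely, and the spherical Fourier transform $f\mapsto\hat f$ is a topological isomorphism (a linear homeomorphism) from $\mathcal S_p(\mathfrak X)^{\#}$ onto $\mathcal H(S_p)^{\#}$. -/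

import Mathlib

open scoped ContDiff

noncomputable section

namespace HomogeneousTree

universe u

variable {V : Type u}

/-! ### Functions on a homogeneous tree

The homogeneous tree `𝔛` of degree `q + 1` is a tree `G` on a vertex set `V` that is regular of
degree `q + 1`; `o` is the fixed base point, and `|x|` is `G.dist o x`. -/

/-- The Laplacian `ℒ f(x) = f(x) - (q + 1)⁻¹ ∑_{d(x,y) = 1} f(y)`. -/
def laplacian (G : SimpleGraph V) [G.LocallyFinite] (q : ℕ) (f : V → ℂ) (x : V) : ℂ :=
  f x - (1 / ((q : ℂ) + 1)) * ∑ y ∈ G.neighborFinset x, f y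

/-- `f` is radial: `f(x)` depends only on `|x|`. -/
def IsRadial (G : SimpleGraph V) (o : V) (f : V → ℂ) : Prop :=
  ∀ x y : V, G.dist o x = G.dist o y → f x = f y

/-- `γ(z) = 1 - (q^{1/2 + iz} + q^{1/2 - iz}) / (q + 1)`. -/
def gam (q : ℕ) (z : ℂ) : ℂ :=
  1 - ((q : ℂ) ^ (1 / 2 + Complex.I * z) + (q : ℂ) ^ (1 / 2 - Complex.I * z)) / ((q : ℂ) + 1)

/-- `φ` is the elementary spherical function with parameter `z`: a radial eigenfunction of the
Laplacian with eigenvalue `γ(z)`, normalized by `φ(o) = 1`. -/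
structure IsSpherical (G : SimpleGraph V) [G.LocallyFinite] (o : V) (q : ℕ) (z : ℂ)
    (φ : V → ℂ) : Prop where
  radial : IsRadial G o φ
  eigen : ∀ x, laplacian G q φ x = gam q z * φ x
  base : φ o = 1

/-- The values of the spherical function on the spheres around `o`, read off from the eigenvalue
equation at `o` and at the vertices at distance `n + 1` from `o`. -/
def sphericalSeq (q : ℕ) (z : ℂ) : ℕ → ℂ
  | 0 => 1
  | 1 => 1 - gam q z
  | n + 2 =>
    (((q : ℂ) + 1) * (1 - gam q z) * sphericalSeq q z (n + 1) - sphericalSeq q z n) / (q : ℂ)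

/-- The elementary spherical function `φ_z`. By `isSpherical_iff` below it is the one and only
radial eigenfunction of the Laplacian with eigenvalue `γ(z)` and value `1` at `o`. -/
def spherical (G : SimpleGraph V) (o : V) (q : ℕ) (z : ℂ) (x : V) : ℂ :=
  sphericalSeq q z (G.dist o x)

theorem exists_parent {G : SimpleGraph V} (hG : G.IsTree) {o x : V} {n : ℕ}
    (hx : G.dist o x = n + 1) :
    ∃ y, G.Adj x y ∧ G.dist o y = n ∧ ∀ w, G.Adj x w → w ≠ y → G.dist o w = n + 2 := by
  obtain ⟨p, hp, hl⟩ := hG.connected.exists_path_of_dist o x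
  have hnil : ¬ p.Nil := by
    intro h
    have := SimpleGraph.Walk.length_eq_zero_iff.mpr h
    omega
  have key : ∀ w, G.Adj x w → G.dist o w = n → w = p.penultimate := by
    intro w hw hd
    obtain ⟨r, hr, hrl⟩ := hG.connected.exists_path_of_dist o w
    have hl2 : (r.concat hw.symm).length = G.dist o x := by
      rw [SimpleGraph.Walk.length_concat]; omega
    have hpath := SimpleGraph.Walk.isPath_of_length_eq_dist _ hl2
    have he : r.concat hw.symm = p := (hG.existsUnique_path o x).unique hpath hp
    rw [← he, SimpleGraph.Walk.penultimate_concat]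
  have hadj : G.Adj x p.penultimate := (p.adj_penultimate hnil).symm
  have hle : G.dist o p.penultimate ≤ n := by
    have h1 := SimpleGraph.dist_le p.dropLast
    have h2 : p.dropLast.length + 1 = p.length := by
      have := congrArg SimpleGraph.Walk.length
        (SimpleGraph.Walk.concat_dropLast (p.adj_penultimate hnil))
      rwa [SimpleGraph.Walk.length_concat] at this
    omega
  refine ⟨p.penultimate, hadj, ?_, ?_⟩
  · have := hG.dist_eq_dist_add_one_of_adj o hadj
    omega
  · intro w hw hne
    have h1 := hG.dist_eq_dist_add_one_of_adj o hw
    have h2 : G.dist o w ≠ n := fun h => hne (key w hw h)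
    omega

theorem sum_neighbors {G : SimpleGraph V} [G.LocallyFinite] (hG : G.IsTree) {q : ℕ}
    (hreg : G.IsRegularOfDegree (q + 1)) {o x : V} {n : ℕ} (hx : G.dist o x = n + 1)
    (f : V → ℂ) (a b : ℂ) (ha : ∀ y, G.dist o y = n → f y = a)
    (hb : ∀ y, G.dist o y = n + 2 → f y = b) :
    ∑ y ∈ G.neighborFinset x, f y = a + q * b := by
  classical
  obtain ⟨y, hxy, hy, hrest⟩ := exists_parent hG hx
  have hmem : y ∈ G.neighborFinset x := by simpa using hxy
  rw [← Finset.add_sum_erase _ _ hmem, ha y hy]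
  congr 1
  rw [Finset.sum_congr rfl (g := fun _ => b)]
  · rw [Finset.sum_const, Finset.card_erase_of_mem hmem, SimpleGraph.card_neighborFinset_eq_degree,
      hreg x]
    simp
  · intro w hw
    rw [Finset.mem_erase] at hw
    exact hb w (hrest w (by simpa using hw.2) hw.1)

theorem sum_neighbors_base {G : SimpleGraph V} [G.LocallyFinite] {q : ℕ}
    (hreg : G.IsRegularOfDegree (q + 1)) {o : V} (f : V → ℂ) (b : ℂ)
    (hb : ∀ y, G.dist o y = 1 → f y = b) :
    ∑ y ∈ G.neighborFinset o, f y = (q + 1) * b := by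
  rw [Finset.sum_congr rfl (g := fun _ => b)]
  · rw [Finset.sum_const, SimpleGraph.card_neighborFinset_eq_degree, hreg o]
    simp
  · intro w hw
    exact hb w (SimpleGraph.dist_eq_one_iff_adj.mpr (by simpa using hw))

/-- `φ_z` is the unique radial eigenfunction of the Laplacian with eigenvalue `γ(z)` that takes the
value `1` at `o`. -/
theorem isSpherical_iff {G : SimpleGraph V} [G.LocallyFinite] (hG : G.IsTree) {q : ℕ} (hq : 1 ≤ q)
    (hreg : G.IsRegularOfDegree (q + 1)) (o : V) (z : ℂ) (φ : V → ℂ) :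
    IsSpherical G o q z φ ↔ φ = spherical G o q z := by
  have hq0 : (q : ℂ) ≠ 0 := by
    have : q ≠ 0 := by omega
    exact_mod_cast this
  have hq1 : (q : ℂ) + 1 ≠ 0 := by exact_mod_cast Nat.succ_ne_zero q
  constructor
  · intro h
    have key : ∀ n x, G.dist o x = n → φ x = sphericalSeq q z n := by
      intro n
      induction n using Nat.strong_induction_on with
      | _ n ih =>
        match n, ih with
        | 0, _ =>
          intro x hx
          have : o = x := hG.connected.dist_eq_zero_iff.mp hx
          rw [← this, h.base, sphericalSeq]
        | 1, _ =>
          intro x hx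
          have hs := sum_neighbors_base hreg (o := o) φ (φ x)
            (fun y hy => h.radial y x (hy.trans hx.symm))
          have he := h.eigen o
          rw [laplacian, hs, h.base] at he
          rw [sphericalSeq, ← mul_one (gam q z), ← he]
          field_simp
          ring
        | n + 2, ih =>
          intro x hx
          obtain ⟨y, -, hy, -⟩ := exists_parent hG hx
          have hs := sum_neighbors hG hreg hy φ (sphericalSeq q z n) (φ x)
            (ih n (by omega)) (fun w hw => h.radial w x (hw.trans hx.symm))
          have he := h.eigen y
          rw [laplacian, hs, ih (n + 1) (by omega) y hy] at he
          rw [sphericalSeq]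
          field_simp at he ⊢
          linear_combination -he
    funext x
    exact key _ x rfl
  · rintro rfl
    refine ⟨fun x y hxy => by simp [spherical, hxy], fun x => ?_, by simp [spherical, sphericalSeq]⟩
    have hval : ∀ n, ∀ y, G.dist o y = n → spherical G o q z y = sphericalSeq q z n :=
      fun n y hy => by rw [spherical, hy]
    rcases hx : G.dist o x with _ | n
    · have : o = x := hG.connected.dist_eq_zero_iff.mp hx
      subst this
      rw [laplacian, sum_neighbors_base hreg _ _ (hval 1), hval 0 o hx, sphericalSeq, sphericalSeq]
      field_simp
      ring
    · rw [laplacian, sum_neighbors hG hreg hx _ _ _ (hval n) (hval (n + 2)), hval (n + 1) x hx,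
        sphericalSeq.eq_3]
      field_simp
      ring

/-- The spherical Fourier transform `f̂(z) = ∑_{x ∈ 𝔛} f(x) φ_z(x)`. -/
def sphericalTransform (G : SimpleGraph V) (o : V) (q : ℕ) (f : V → ℂ) (z : ℂ) : ℂ :=
  ∑' x : V, f x * spherical G o q z x

/-! ### The Schwartz spaces -/

/-- The weighted value `(1 + |x|)^m q^{|x|/p} |f(x)|`. -/
def weighted (G : SimpleGraph V) (o : V) (q : ℕ) (p : ℝ) (m : ℕ) (f : V → ℂ) (x : V) : ℝ :=
  (1 + (G.dist o x : ℝ)) ^ m * (q : ℝ) ^ ((G.dist o x : ℝ) / p) * ‖f x‖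

theorem weighted_nonneg (G : SimpleGraph V) (o : V) (q : ℕ) (p : ℝ) (m : ℕ) (f : V → ℂ) (x : V) :
    0 ≤ weighted G o q p m f x := by
  unfold weighted; positivity

theorem weighted_add_le (G : SimpleGraph V) (o : V) (q : ℕ) (p : ℝ) (m : ℕ) (f g : V → ℂ) (x : V) :
    weighted G o q p m (f + g) x ≤ weighted G o q p m f x + weighted G o q p m g x := by
  unfold weighted
  rw [← mul_add]
  exact mul_le_mul_of_nonneg_left (norm_add_le _ _) (by positivity)

theorem weighted_smul (G : SimpleGraph V) (o : V) (q : ℕ) (p : ℝ) (m : ℕ) (c : ℂ) (f : V → ℂ)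
    (x : V) : weighted G o q p m (c • f) x = ‖c‖ * weighted G o q p m f x := by
  simp only [weighted, Pi.smul_apply, norm_smul]; ring

/-- The `p`-Schwartz space `𝒮_p(𝔛)`, as a space of functions on the vertices:
`sup_x (1 + |x|)^m q^{|x|/p} |f(x)| < ∞` for every `m ∈ ℕ`. -/
def schwartzSpace (G : SimpleGraph V) (o : V) (q : ℕ) (p : ℝ) : Submodule ℂ (V → ℂ) where
  carrier := {f | ∀ m : ℕ, BddAbove (Set.range (weighted G o q p m f))}
  zero_mem' := fun m => ⟨0, by rintro _ ⟨x, rfl⟩; simp [weighted]⟩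
  add_mem' := by
    intro f g hf hg m
    obtain ⟨A, hA⟩ := hf m
    obtain ⟨B, hB⟩ := hg m
    refine ⟨A + B, ?_⟩
    rintro _ ⟨x, rfl⟩
    exact (weighted_add_le G o q p m f g x).trans (add_le_add (hA ⟨x, rfl⟩) (hB ⟨x, rfl⟩))
  smul_mem' := by
    intro c f hf m
    obtain ⟨A, hA⟩ := hf m
    refine ⟨‖c‖ * A, ?_⟩
    rintro _ ⟨x, rfl⟩
    rw [weighted_smul]
    exact mul_le_mul_of_nonneg_left (hA ⟨x, rfl⟩) (norm_nonneg c)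

/-- The radial functions. -/
def radialSpace (G : SimpleGraph V) (o : V) : Submodule ℂ (V → ℂ) where
  carrier := {f | IsRadial G o f}
  zero_mem' := fun _ _ _ => rfl
  add_mem' := fun hf hg x y h => by simp [hf x y h, hg x y h]
  smul_mem' := fun c f hf x y h => by simp [hf x y h]

/-- `𝒮_p(𝔛)^#`, the radial functions in `𝒮_p(𝔛)`. It is a type of its own, so that it does not
inherit the topology of pointwise convergence. -/
def RadialSchwartz (G : SimpleGraph V) (o : V) (q : ℕ) (p : ℝ) : Type u :=
  ↥(schwartzSpace G o q p ⊓ radialSpace G o)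

namespace RadialSchwartz

variable {G : SimpleGraph V} {o : V} {q : ℕ} {p : ℝ}

instance : AddCommGroup (RadialSchwartz G o q p) :=
  inferInstanceAs (AddCommGroup ↥(schwartzSpace G o q p ⊓ radialSpace G o))

instance : Module ℂ (RadialSchwartz G o q p) :=
  inferInstanceAs (Module ℂ ↥(schwartzSpace G o q p ⊓ radialSpace G o))

/-- The underlying function on the vertices. -/
def toFun (f : RadialSchwartz G o q p) : V → ℂ := f.1

variable (G o q p) in
/-- The seminorm `ν_m(f) = sup_x (1 + |x|)^m q^{|x|/p} |f(x)|`. -/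
def seminorm (m : ℕ) : Seminorm ℂ (RadialSchwartz G o q p) :=
  Seminorm.of (fun f => ⨆ x : V, weighted G o q p m f.toFun x)
    (by
      intro f g
      have : Nonempty V := ⟨o⟩
      refine ciSup_le fun x => (weighted_add_le G o q p m f.toFun g.toFun x).trans ?_
      exact add_le_add (le_ciSup (f.2.1 m) x) (le_ciSup (g.2.1 m) x))
    (by
      intro c f
      rw [Real.mul_iSup_of_nonneg (norm_nonneg c)]
      exact congrArg iSup (funext fun x => weighted_smul G o q p m c f.toFun x))

/-- The topology defined by the seminorms `ν_m`, `m ∈ ℕ`. -/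
instance : TopologicalSpace (RadialSchwartz G o q p) :=
  SeminormFamily.moduleFilterBasis (𝕜 := ℂ) (seminorm G o q p) |>.topology

end RadialSchwartz

/-! ### The spaces of holomorphic functions on the strips -/

/-- `δ_p = 1/p - 1/2`. -/
def delta (p : ℝ) : ℝ := 1 / p - 1 / 2

/-- The closed strip `S_p = {z : |Im z| ≤ |δ_p|}`; in particular `S_2 = ℝ`. -/
def strip (p : ℝ) : Set ℂ := {z | |z.im| ≤ |delta p|}

/-- `τ = 2π / log q`. -/
def tau (q : ℕ) : ℝ := 2 * Real.pi / Real.log q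

/-- Complex derivatives within `S_p` are uniquely determined at every point of `S_p`, also on the
boundary of the strip and, for `p = 2`, on the real line (where they are the usual derivatives with
respect to the real variable). -/
theorem uniqueDiffOn_strip (p : ℝ) : UniqueDiffOn ℂ (strip p) := by
  intro z hz
  rw [uniqueDiffWithinAt_iff_accPt, accPt_iff_nhds]
  intro U hU
  obtain ⟨ε, hε, hU⟩ := Metric.mem_nhds_iff.mp hU
  refine ⟨z + ((ε / 2 : ℝ) : ℂ), ⟨hU ?_, ?_⟩, ?_⟩
  · rw [Metric.mem_ball, dist_eq_norm, add_sub_cancel_left, Complex.norm_real, Real.norm_eq_abs,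
      abs_of_pos (by positivity)]
    linarith
  · simpa [strip] using hz
  · intro h
    have : ((ε / 2 : ℝ) : ℂ) = 0 := by simpa using h
    rw [Complex.ofReal_eq_zero] at this
    linarith

/-- A function on `S_p`, extended by zero to `ℂ`. It is only used through its restriction to
`S_p`, and through derivatives within `S_p`, which do not depend on the extension. -/
def extend {p : ℝ} (g : strip p → ℂ) : ℂ → ℂ := Function.extend Subtype.val g 0

theorem extend_apply {p : ℝ} (g : strip p → ℂ) (z : strip p) : extend g z = g z :=
  Subtype.val_injective.extend_apply g 0 z

theorem extend_add {p : ℝ} (g h : strip p → ℂ) : extend (g + h) = extend g + extend h := by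
  have := Function.extend_add (Subtype.val : strip p → ℂ) g h 0 0
  simpa [extend] using this

theorem extend_smul {p : ℝ} (c : ℂ) (g : strip p → ℂ) : extend (c • g) = c • extend g := by
  have := Function.extend_smul c (Subtype.val : strip p → ℂ) g 0
  simpa [extend] using this

/-- The `m`-th complex derivative of `g` at the point `z` of `S_p`; on the boundary the derivative
is taken within `S_p`. -/
def stripDeriv {p : ℝ} (m : ℕ) (g : strip p → ℂ) (z : strip p) : ℂ :=
  iteratedDerivWithin m (extend g) (strip p) z

theorem stripDeriv_add {p : ℝ} (m : ℕ) {g h : strip p → ℂ}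
    (hg : ContDiffOn ℂ ∞ (extend g) (strip p)) (hh : ContDiffOn ℂ ∞ (extend h) (strip p))
    (z : strip p) : stripDeriv m (g + h) z = stripDeriv m g z + stripDeriv m h z := by
  unfold stripDeriv
  rw [extend_add]
  exact iteratedDerivWithin_add z.2 (uniqueDiffOn_strip p)
    ((hg z z.2).of_le (by exact_mod_cast le_top)) ((hh z z.2).of_le (by exact_mod_cast le_top))

theorem stripDeriv_smul {p : ℝ} (m : ℕ) (c : ℂ) (g : strip p → ℂ) (z : strip p) :
    stripDeriv m (c • g) z = c * stripDeriv m g z := by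
  unfold stripDeriv
  rw [extend_smul, iteratedDerivWithin_const_smul_field, smul_eq_mul]

/-- Membership in `𝓗(S_p)^#`. -/
structure IsHolStrip (q : ℕ) (p : ℝ) (g : strip p → ℂ) : Prop where
  even : ∀ z w : strip p, (w : ℂ) = -z → g w = g z
  periodic : ∀ z w : strip p, (w : ℂ) = z + tau q → g w = g z
  holomorphic : DifferentiableOn ℂ (extend g) (interior (strip p))
  continuous : Continuous g
  /-- The derivatives of all orders exist on all of `S_p`. -/
  smooth : ContDiffOn ℂ ∞ (extend g) (strip p)
  bounded : ∀ m : ℕ, BddAbove (Set.range fun z : strip p => ‖stripDeriv m g z‖)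

/-- `𝓗(S_p)^#`, as a space of functions on `S_p`. -/
def holSpace (q : ℕ) (p : ℝ) : Submodule ℂ (strip p → ℂ) where
  carrier := {g | IsHolStrip q p g}
  zero_mem' := by
    have h0 : extend (0 : strip p → ℂ) = 0 := by simpa using extend_smul 0 (0 : strip p → ℂ)
    refine ⟨fun _ _ _ => rfl, fun _ _ _ => rfl, ?_, continuous_const, ?_, fun m => ⟨0, ?_⟩⟩
    · rw [h0]; exact differentiableOn_const 0
    · rw [h0]; exact contDiffOn_const
    · rintro _ ⟨z, rfl⟩
      have := stripDeriv_smul m 0 (0 : strip p → ℂ) z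
      simp only [smul_zero, zero_mul] at this
      simp [this]
  add_mem' := by
    intro g h hg hh
    refine ⟨fun z w e => ?_, fun z w e => ?_, ?_, hg.continuous.add hh.continuous, ?_, fun m => ?_⟩
    · simp [hg.even z w e, hh.even z w e]
    · simp [hg.periodic z w e, hh.periodic z w e]
    · rw [extend_add]; exact hg.holomorphic.add hh.holomorphic
    · rw [extend_add]; exact hg.smooth.add hh.smooth
    · obtain ⟨A, hA⟩ := hg.bounded m
      obtain ⟨B, hB⟩ := hh.bounded m
      refine ⟨A + B, ?_⟩
      rintro _ ⟨z, rfl⟩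
      simp only
      rw [stripDeriv_add m hg.smooth hh.smooth]
      exact (norm_add_le _ _).trans (add_le_add (hA ⟨z, rfl⟩) (hB ⟨z, rfl⟩))
  smul_mem' := by
    intro c g hg
    refine ⟨fun z w e => ?_, fun z w e => ?_, ?_, hg.continuous.const_smul c, ?_, fun m => ?_⟩
    · simp [hg.even z w e]
    · simp [hg.periodic z w e]
    · rw [extend_smul]; exact hg.holomorphic.const_smul c
    · rw [extend_smul]; exact hg.smooth.const_smul c
    · obtain ⟨A, hA⟩ := hg.bounded m
      refine ⟨‖c‖ * A, ?_⟩
      rintro _ ⟨z, rfl⟩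
      simp only
      rw [stripDeriv_smul, norm_mul]
      exact mul_le_mul_of_nonneg_left (hA ⟨z, rfl⟩) (norm_nonneg c)

/-- `𝓗(S_p)^#`: the even, `τ`-periodic functions on `S_p` that are holomorphic in the interior and
continuous on `S_p`, with all derivatives bounded on `S_p`. It is a type of its own, so that it does
not inherit the topology of pointwise convergence. -/
def HolStrip (q : ℕ) (p : ℝ) : Type := ↥(holSpace q p)

namespace HolStrip

variable {q : ℕ} {p : ℝ}

instance : AddCommGroup (HolStrip q p) := inferInstanceAs (AddCommGroup ↥(holSpace q p))

instance : Module ℂ (HolStrip q p) := inferInstanceAs (Module ℂ ↥(holSpace q p))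

/-- The underlying function on `S_p`. -/
def toFun (g : HolStrip q p) : strip p → ℂ := g.1

variable (q p) in
/-- The seminorm `μ_m(g) = sup_{z ∈ S_p} |g^{(m)}(z)|`. -/
def seminorm (m : ℕ) : Seminorm ℂ (HolStrip q p) :=
  Seminorm.of (fun g => ⨆ z : strip p, ‖stripDeriv m g.toFun z‖)
    (by
      intro g h
      have : Nonempty (strip p) := ⟨⟨0, by simp [strip]⟩⟩
      refine ciSup_le fun z => ?_
      have e : stripDeriv m (g + h).toFun z = stripDeriv m g.toFun z + stripDeriv m h.toFun z :=
        stripDeriv_add m g.2.smooth h.2.smooth z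
      rw [e]
      exact (norm_add_le _ _).trans
        (add_le_add (le_ciSup (g.2.bounded m) z) (le_ciSup (h.2.bounded m) z)))
    (by
      intro c g
      rw [Real.mul_iSup_of_nonneg (norm_nonneg c)]
      refine congrArg iSup (funext fun z => ?_)
      rw [← norm_mul]
      exact congrArg norm (stripDeriv_smul m c g.toFun z))

/-- The topology defined by the seminorms `μ_m`, `m ∈ ℕ`. -/
instance : TopologicalSpace (HolStrip q p) :=
  SeminormFamily.moduleFilterBasis (𝕜 := ℂ) (seminorm q p) |>.topology

end HolStrip

end HomogeneousTree

end

namespace HomogeneousTree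

universe u

variable {V : Type u}

/-! The transform factors as an Abel transform followed by a Fourier series, and each factor is an
isomorphism with explicit estimates.

Put `L = log q`, `w = e^{iLz}`, let `U_n = wⁿ + wⁿ⁻² + ⋯ + w⁻ⁿ` (zero for negative `n`), and for a
radial `f` with values `F(n)` put `h(n) = q^{n/2} F(n)`. Solving the recurrence of the spherical
function gives that the sphere of radius `n` contributes `h(n) (U_n - q⁻¹ U_{n-2})`
(`sphereCard_mul_sphericalSeq`). Since `U_n - U_{n-2}` is `wⁿ + w⁻ⁿ`, or `1` if `n = 0`, summation
by parts turns the transform into `∑_{k ∈ ℤ} A(|k|) e^{ikLz}` with `A(n) = h(n) + (1 - q⁻¹) ∑_j h(n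
+ 2 + 2j)` (`hasSum_sphericalSeq`).

The weights match: with `r = q^{|δ_p|}`, the bound for `e^{±iLz}` on `S_p`, the seminorm `ν_m` is
the supremum of `(1 + n)^m rⁿ |h(n)|` (`weighted_eq`). The passage from `h` to `A` preserves
finiteness of all these suprema and is inverted by a similar sum with geometric coefficients
(`norm_abelSum_le`, `abelSum_abelSum`). Rapid decay of `A` makes the exponential series smooth on
the closed strip by termwise differentiation (`RapidDecay.hasDerivWithinAt`). Conversely, the
Fourier coefficients of a function in the target space decay rapidly: shifting the line of
integration to an edge of the strip gains `r^{-|k|}`, and integrating by parts gains powers of `|k|`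
(`lineCoeff_decay`). Every step loses finitely many orders of the seminorms, so both directions are
continuous. -/

/-! ### Counting vertices on spheres -/

/-- The number of vertices at distance `n` from a given vertex. -/
def sphereCard (q : ℕ) : ℕ → ℕ
  | 0 => 1
  | n + 1 => (q + 1) * q ^ n

/-- A vertex of the next sphere has exactly one neighbour closer to `o`. The sets of outward
neighbours of the vertices of a sphere are therefore disjoint and cover the next sphere. -/
theorem exists_sphere {G : SimpleGraph V} [G.LocallyFinite] (hG : G.IsTree) {q : ℕ}
    (hreg : G.IsRegularOfDegree (q + 1)) (o : V) (n : ℕ) :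
    ∃ S : Finset V, (∀ x, x ∈ S ↔ G.dist o x = n) ∧ S.card = sphereCard q n := by
  classical
  have step : ∀ (n c : ℕ) (S : Finset V), (∀ x, x ∈ S ↔ G.dist o x = n) →
      (∀ x ∈ S, ((G.neighborFinset x).filter fun y => G.dist o y = n + 1).card = c) →
      ∃ T : Finset V, (∀ x, x ∈ T ↔ G.dist o x = n + 1) ∧ T.card = S.card * c := by
    intro n c S hS hc
    refine ⟨S.biUnion fun x => (G.neighborFinset x).filter fun y => G.dist o y = n + 1, ?_, ?_⟩
    · intro x
      simp only [Finset.mem_biUnion, Finset.mem_filter, SimpleGraph.mem_neighborFinset]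
      constructor
      · rintro ⟨_, _, _, h⟩
        exact h
      · intro hx
        obtain ⟨y, hxy, hy, -⟩ := exists_parent hG hx
        exact ⟨y, (hS y).2 hy, hxy.symm, hx⟩
    · rw [Finset.card_biUnion, Finset.sum_congr rfl hc, Finset.sum_const, smul_eq_mul]
      intro x hx y hy hxy
      rw [Function.onFun, Finset.disjoint_left]
      intro w hw hw'
      simp only [Finset.mem_filter, SimpleGraph.mem_neighborFinset] at hw hw'
      obtain ⟨v, -, -, huniq⟩ := exists_parent hG hw.2
      have key : ∀ t, t ∈ S → G.Adj w t → t = v := by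
        intro t ht hwt
        by_contra hne
        have := huniq t hwt hne
        have := (hS t).1 ht
        omega
      exact hxy ((key x hx hw.1.symm).trans (key y hy hw'.1.symm).symm)
  induction n with
  | zero =>
    refine ⟨{o}, fun x => ?_, by simp [sphereCard]⟩
    rw [Finset.mem_singleton, hG.connected.dist_eq_zero_iff, eq_comm]
  | succ n ih =>
    obtain ⟨S, hS, hcard⟩ := ih
    rcases n with _ | n
    · obtain ⟨T, hT, hTc⟩ := step 0 (q + 1) S hS (by
        intro x hx
        have hx0 : o = x := hG.connected.dist_eq_zero_iff.mp ((hS x).1 hx)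
        subst hx0
        -- Outward neighbours are counted by summing the indicator function of the next sphere over
        -- all neighbours.
        have := sum_neighbors_base hreg (o := o) (fun y => if G.dist o y = 1 then (1 : ℂ) else 0) 1
          (fun y hy => by simp [hy])
        rw [← Finset.sum_filter, Finset.sum_const, nsmul_eq_mul, mul_one, mul_one] at this
        exact_mod_cast this)
      exact ⟨T, hT, by rw [hTc, hcard]; simp [sphereCard]⟩
    · obtain ⟨T, hT, hTc⟩ := step (n + 1) q S hS (by
        intro x hx
        have := sum_neighbors hG hreg ((hS x).1 hx)
          (fun y => if G.dist o y = n + 1 + 1 then (1 : ℂ) else 0) 0 1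
          (fun y hy => by simp only [hy]; rw [if_neg (by omega)]) (fun y hy => by simp [hy])
        rw [← Finset.sum_filter, Finset.sum_const, nsmul_eq_mul, mul_one, mul_one, zero_add] at this
        exact_mod_cast this)
      exact ⟨T, hT, by rw [hTc, hcard]; simp only [sphereCard]; ring⟩

theorem sphereCard_pos {q : ℕ} (hq : 0 < q) (n : ℕ) : 0 < sphereCard q n := by
  cases n <;> simp [sphereCard, hq]

theorem exists_dist_eq {G : SimpleGraph V} [G.LocallyFinite] (hG : G.IsTree) {q : ℕ} (hq : 0 < q)
    (hreg : G.IsRegularOfDegree (q + 1)) (o : V) (n : ℕ) : ∃ x, G.dist o x = n := by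
  obtain ⟨S, hS, hc⟩ := exists_sphere hG hreg o n
  obtain ⟨x, hx⟩ := Finset.card_pos.1 (hc ▸ sphereCard_pos hq n)
  exact ⟨x, (hS x).1 hx⟩

/-- Summation of a radial function over the tree. -/
theorem hasSum_radial {G : SimpleGraph V} [G.LocallyFinite] (hG : G.IsTree) {q : ℕ}
    (hreg : G.IsRegularOfDegree (q + 1)) (o : V) (F : ℕ → ℂ) {a : ℂ}
    (hF : Summable fun n => (sphereCard q n : ℝ) * ‖F n‖)
    (ha : HasSum (fun n => (sphereCard q n : ℂ) * F n) a) :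
    HasSum (fun x : V => F (G.dist o x)) a := by
  have hfin : ∀ n, ∃ i : Fintype {x // G.dist o x = n},
      @Fintype.card {x // G.dist o x = n} i = sphereCard q n := by
    intro n
    obtain ⟨S, hS, hc⟩ := exists_sphere hG hreg o n
    exact ⟨Fintype.subtype S hS, by rw [Fintype.subtype_card, hc]⟩
  choose inst hcard using hfin
  have hfiber : ∀ (n : ℕ) (x : {x // G.dist o x = n}), F (G.dist o x) = F n := by
    rintro n ⟨x, rfl⟩
    rfl
  have hsum : Summable fun x : V => F (G.dist o x) := by
    rw [← (Equiv.sigmaFiberEquiv (G.dist o)).summable_iff]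
    refine Summable.of_norm ?_
    rw [summable_sigma_of_nonneg fun _ => norm_nonneg _]
    refine ⟨fun n => (hasSum_fintype _).summable, hF.congr fun n => ?_⟩
    rw [tsum_fintype]
    simp [Equiv.sigmaFiberEquiv, hfiber, hcard]
  have hs := hsum
  rw [← (Equiv.sigmaFiberEquiv (G.dist o)).summable_iff] at hs
  have h2 := hs.hasSum.sigma (g := fun n => (sphereCard q n : ℂ) * F n) (fun n => by
    have := hasSum_fintype
      (fun x : {x // G.dist o x = n} =>
        ((fun x : V => F (G.dist o x)) ∘ (Equiv.sigmaFiberEquiv (G.dist o))) ⟨n, x⟩)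
    convert this using 1
    simp [Equiv.sigmaFiberEquiv, hfiber, hcard])
  rw [← (Equiv.sigmaFiberEquiv (G.dist o)).hasSum_iff, ha.unique h2]
  exact hs.hasSum

/-! ### The spherical functions in terms of exponentials -/

/-- `wⁿ + w⁻ⁿ` for `n ≥ 1`, and `1` for `n = 0`. -/
noncomputable def symPow (w : ℂ) (n : ℕ) : ℂ := if n = 0 then 1 else w ^ n + w⁻¹ ^ n

/-- The shifted Chebyshev function of the second kind: `chebShift w (n + 2)` is
`wⁿ + wⁿ⁻² + ⋯ + w⁻ⁿ`. -/
noncomputable def chebShift (w : ℂ) : ℕ → ℂ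
  | 0 => 0
  | 1 => 0
  | n + 2 => chebShift w n + symPow w n

theorem symPow_succ_add {w : ℂ} (hw : w ≠ 0) (n : ℕ) :
    symPow w (n + 3) + symPow w (n + 1) = (w + w⁻¹) * symPow w (n + 2) := by
  simp only [symPow, Nat.add_eq_zero_iff, OfNat.ofNat_ne_zero, one_ne_zero, and_false, if_false]
  have h : w * w⁻¹ = 1 := mul_inv_cancel₀ hw
  simp only [pow_succ]
  linear_combination (-(w ^ n * w) - w⁻¹ ^ n * w⁻¹) * h

/-- The recurrence starts at index 1 and fails at index 0: the Chebyshev continuation would have the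
value `-1` there, whereas `chebShift w 0 = 0`. The value `0` is the one that makes
`sphereCard_mul_sphericalSeq` correct at the base point. -/
theorem chebShift_succ_add {w : ℂ} (hw : w ≠ 0) (n : ℕ) :
    chebShift w (n + 3) + chebShift w (n + 1) = (w + w⁻¹) * chebShift w (n + 2) := by
  have h : w * w⁻¹ = 1 := mul_inv_cancel₀ hw
  induction n using Nat.twoStepInduction with
  | zero => simp [chebShift, symPow]
  | one =>
    simp [chebShift, symPow]
    linear_combination -2 * h
  | more n ih _ =>
    have := symPow_succ_add hw n
    simp only [chebShift] at ih ⊢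
    linear_combination ih + this

theorem gam_eq {q : ℕ} (hq : 0 < q) (z : ℂ) :
    1 - gam q z = ((Real.sqrt q : ℝ) : ℂ) * (Complex.exp (Complex.I * Real.log q * z) +
      (Complex.exp (Complex.I * Real.log q * z))⁻¹) / ((q : ℂ) + 1) := by
  have hq0 : (q : ℂ) ≠ 0 := by exact_mod_cast hq.ne'
  have hs : (q : ℂ) ^ (1 / 2 : ℂ) = ((Real.sqrt q : ℝ) : ℂ) := by
    rw [Real.sqrt_eq_rpow, Complex.ofReal_cpow (by positivity)]
    push_cast
    rfl
  have hlog : Complex.log q = ((Real.log q : ℝ) : ℂ) := by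
    rw [Complex.ofReal_log (by positivity), Complex.ofReal_natCast]
  have h1 : (q : ℂ) ^ (Complex.I * z) = Complex.exp (Complex.I * Real.log q * z) := by
    rw [Complex.cpow_def_of_ne_zero hq0, hlog]
    congr 1
    ring
  rw [gam, Complex.cpow_add _ _ hq0, Complex.cpow_sub _ _ hq0, hs, h1]
  ring

/-- After scaling by powers of `s = √q`, the spherical recurrence becomes the Chebyshev recurrence,
so it suffices to compare two initial values. The index starts at 1 because the eigenvalue equation
at `o` has a different shape. -/
theorem sphericalSeq_eq {q : ℕ} (hq : 0 < q) {s w z : ℂ} (hs : s ^ 2 = q) (hw : w ≠ 0)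
    (hz : 1 - gam q z = s * (w + w⁻¹) / ((q : ℂ) + 1)) (n : ℕ) :
    s ^ (n + 1) * ((q : ℂ) + 1) * sphericalSeq q z (n + 1) =
      q * chebShift w (n + 3) - chebShift w (n + 1) := by
  have hq0 : (q : ℂ) ≠ 0 := by exact_mod_cast hq.ne'
  have hq1 : (q : ℂ) + 1 ≠ 0 := by exact_mod_cast Nat.succ_ne_zero q
  have hww : w * w⁻¹ = 1 := mul_inv_cancel₀ hw
  have hrec : ∀ n, (q : ℂ) * sphericalSeq q z (n + 2) =
      s * (w + w⁻¹) * sphericalSeq q z (n + 1) - sphericalSeq q z n := by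
    intro n
    rw [sphericalSeq, hz]
    field_simp
  have h1 : ((q : ℂ) + 1) * sphericalSeq q z 1 = s * (w + w⁻¹) := by
    rw [sphericalSeq, hz]
    field_simp
  induction n using Nat.twoStepInduction with
  | zero =>
    simp [chebShift, symPow]
    linear_combination s * h1 + (w + w⁻¹) * hs
  | one =>
    have h2 := hrec 0
    have h0 : sphericalSeq q z 0 = 1 := rfl
    simp only [zero_add, h0] at h2
    simp [chebShift, symPow]
    refine mul_left_cancel₀ hq0 ?_
    linear_combination (s ^ 2 * (q + 1)) * h2 + (s ^ 3 * (w + w⁻¹)) * h1 +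
      ((s^2 + q) * (w + w⁻¹) ^ 2 - (q + 1)) * hs + 2 * (q : ℂ) ^ 2 * hww
  | more n ih1 ih2 =>
    have h2 := hrec (n + 1)
    have c1 := chebShift_succ_add hw (n + 2)
    have c2 := chebShift_succ_add hw n
    refine mul_left_cancel₀ hq0 ?_
    linear_combination (s ^ (n + 3) * (q + 1)) * h2 + (s ^ 2 * (w + w⁻¹)) * ih2 - s ^ 2 * ih1 -
      q * (q * c1 - c2) + ((w + w⁻¹) * (q * chebShift w (n + 4) - chebShift w (n + 2)) -
        (q * chebShift w (n + 3) - chebShift w (n + 1))) * hs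

theorem sphereCard_mul_sphericalSeq {q : ℕ} (hq : 0 < q) (z : ℂ) (n : ℕ) :
    (sphereCard q n : ℂ) * sphericalSeq q z n = ((Real.sqrt q : ℝ) : ℂ) ^ n *
      (chebShift (Complex.exp (Complex.I * Real.log q * z)) (n + 2) -
        chebShift (Complex.exp (Complex.I * Real.log q * z)) n / q) := by
  have hq0 : (q : ℂ) ≠ 0 := by exact_mod_cast hq.ne'
  have hs : ((Real.sqrt q : ℝ) : ℂ) ^ 2 = q := by
    rw [← Complex.ofReal_pow, Real.sq_sqrt (by positivity), Complex.ofReal_natCast]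
  rcases n with _ | n
  · simp [sphereCard, sphericalSeq, chebShift, symPow]
  · have h := sphericalSeq_eq hq hs (Complex.exp_ne_zero _) (gam_eq hq z) n
    have hp : ((Real.sqrt q : ℝ) : ℂ) ^ (n + 1) * ((Real.sqrt q : ℝ) : ℂ) ^ (n + 1) =
        (q : ℂ) ^ n * q := by
      rw [← pow_add, ← two_mul, pow_mul, hs, pow_succ]
    generalize Complex.exp (Complex.I * Real.log q * z) = w at h ⊢
    simp only [sphereCard]
    push_cast
    field_simp
    linear_combination ((Real.sqrt q : ℝ) : ℂ) ^ (n + 1) * h -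
      (q + 1) * sphericalSeq q z (n + 1) * hp

theorem norm_symPow_le {w : ℂ} {r : ℝ} (h1 : ‖w‖ ≤ r) (h2 : ‖w⁻¹‖ ≤ r) (n : ℕ) :
    ‖symPow w n‖ ≤ 2 * r ^ n := by
  unfold symPow
  split_ifs with h
  · simp [h]
  · refine (norm_add_le _ _).trans ?_
    rw [norm_pow, norm_pow]
    linarith [pow_le_pow_left₀ (norm_nonneg w) h1 n, pow_le_pow_left₀ (norm_nonneg w⁻¹) h2 n]

theorem norm_chebShift_le {w : ℂ} {r : ℝ} (hr : 1 ≤ r) (h1 : ‖w‖ ≤ r) (h2 : ‖w⁻¹‖ ≤ r) (n : ℕ) :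
    ‖chebShift w (n + 2)‖ ≤ 2 * (n + 1) * r ^ n := by
  have hr0 : (0 : ℝ) ≤ r := by linarith
  induction n using Nat.twoStepInduction with
  | zero =>
    have := norm_symPow_le h1 h2 0
    simpa [chebShift] using this
  | one =>
    have := norm_symPow_le h1 h2 1
    simp [chebShift] at this ⊢
    linarith
  | more n ih _ =>
    have := norm_symPow_le h1 h2 (n + 2)
    rw [chebShift]
    refine (norm_add_le _ _).trans ?_
    have h3 : r ^ n ≤ r ^ (n + 2) := pow_le_pow_right₀ hr (by omega)
    have h4 : (0 : ℝ) ≤ r ^ (n + 2) := by positivity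
    push_cast
    nlinarith [mul_le_mul_of_nonneg_left h3 (by positivity : (0 : ℝ) ≤ 2 * (n + 1))]

/-! ### Differentiating series within convex sets -/

/-- A second-order Taylor bound from two uses of the mean value inequality: first for `f'`, then for
`x ↦ f x - x * f' z`. -/
theorem norm_sub_sub_le_of_convex {S : Set ℂ} (hS : Convex ℝ S) {f f' f'' : ℂ → ℂ} {C : ℝ}
    (hf : ∀ z ∈ S, HasDerivWithinAt f (f' z) S z) (hf' : ∀ z ∈ S, HasDerivWithinAt f' (f'' z) S z)
    (hC : ∀ z ∈ S, ‖f'' z‖ ≤ C) {z y : ℂ} (hz : z ∈ S) (hy : y ∈ S) :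
    ‖f y - f z - (y - z) * f' z‖ ≤ C * ‖y - z‖ ^ 2 := by
  have hC0 : 0 ≤ C := (norm_nonneg _).trans (hC z hz)
  have hlip : ∀ x ∈ S, ‖f' x - f' z‖ ≤ C * ‖x - z‖ := fun x hx =>
    hS.norm_image_sub_le_of_norm_hasDerivWithin_le hf' hC hz hx
  -- Cutting with the ball keeps the set convex and makes `‖f' x - f' z‖` at most `C * ‖y - z‖` on
  -- it.
  have hT : Convex ℝ (S ∩ Metric.closedBall z ‖y - z‖) := hS.inter (convex_closedBall _ _)
  have key := hT.norm_image_sub_le_of_norm_hasDerivWithin_le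
    (f := fun x => f x - x * f' z) (f' := fun x => f' x - f' z) (C := C * ‖y - z‖)
    (fun x hx => by
      have := ((hf x hx.1).mono Set.inter_subset_left).sub
        ((hasDerivWithinAt_id x (S ∩ Metric.closedBall z ‖y - z‖)).mul_const (f' z))
      simpa [Pi.sub_def] using this)
    (fun x hx => (hlip x hx.1).trans
      (mul_le_mul_of_nonneg_left (by simpa [dist_eq_norm] using hx.2) hC0))
    (x := z) (y := y) ⟨hz, by simp⟩ ⟨hy, by simp [dist_eq_norm]⟩
  calc ‖f y - f z - (y - z) * f' z‖ = ‖f y - y * f' z - (f z - z * f' z)‖ := by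
        congr 1
        ring
    _ ≤ C * ‖y - z‖ * ‖y - z‖ := key
    _ = C * ‖y - z‖ ^ 2 := by ring

/-- The Taylor remainders of the terms are bounded by `u i * ‖y - z‖ ^ 2`, so their sum is `o(‖y -
z‖)`. Only convexity of `S` enters, which covers boundary points of the strip and the degenerate
strip `ℝ`. -/
theorem hasDerivWithinAt_tsum_of_convex {ι : Type*} {S : Set ℂ} (hS : Convex ℝ S)
    {f f' f'' : ι → ℂ → ℂ} {u : ι → ℝ} (hu : Summable u)
    (hf : ∀ i, ∀ z ∈ S, HasDerivWithinAt (f i) (f' i z) S z)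
    (hf' : ∀ i, ∀ z ∈ S, HasDerivWithinAt (f' i) (f'' i z) S z)
    (hbound : ∀ i, ∀ z ∈ S, ‖f'' i z‖ ≤ u i)
    (hsum : ∀ z ∈ S, Summable fun i => f i z) (hsum' : ∀ z ∈ S, Summable fun i => f' i z)
    {z : ℂ} (hz : z ∈ S) :
    HasDerivWithinAt (fun z => ∑' i, f i z) (∑' i, f' i z) S z := by
  rw [hasDerivWithinAt_iff_isLittleO]
  refine Asymptotics.IsBigO.trans_isLittleO (g := fun y => ‖y - z‖ ^ 2) ?_
    ((Asymptotics.isLittleO_pow_sub_sub z one_lt_two).mono nhdsWithin_le_nhds)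
  refine Asymptotics.IsBigO.of_bound (∑' i, u i) ?_
  filter_upwards [self_mem_nhdsWithin] with y hy
  rw [smul_eq_mul, ← (hsum y hy).tsum_sub (hsum z hz), ← tsum_mul_left,
    ← ((hsum y hy).sub (hsum z hz)).tsum_sub ((hsum' z hz).mul_left _), norm_pow, norm_norm]
  exact tsum_of_norm_bounded ((hu.hasSum).mul_right _) fun i =>
    norm_sub_sub_le_of_convex hS (hf i) (hf' i) (hbound i) hz hy

theorem eqOn_iteratedDerivWithin {S : Set ℂ} (hS : UniqueDiffOn ℂ S) {f : ℂ → ℂ} {G : ℕ → ℂ → ℂ}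
    (h0 : Set.EqOn f (G 0) S) (hG : ∀ m, ∀ z ∈ S, HasDerivWithinAt (G m) (G (m + 1) z) S z)
    (m : ℕ) : Set.EqOn (iteratedDerivWithin m f S) (G m) S := by
  induction m with
  | zero => simpa using h0
  | succ m ih =>
    intro z hz
    rw [iteratedDerivWithin_succ, derivWithin_congr ih (ih hz)]
    exact (hG m z hz).derivWithin (hS z hz)

theorem contDiffOn_of_hasDerivWithinAt {S : Set ℂ} (hS : UniqueDiffOn ℂ S) {f : ℂ → ℂ}
    {G : ℕ → ℂ → ℂ} (h0 : Set.EqOn f (G 0) S)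
    (hG : ∀ m, ∀ z ∈ S, HasDerivWithinAt (G m) (G (m + 1) z) S z) : ContDiffOn ℂ ∞ f S := by
  refine contDiffOn_of_differentiableOn_deriv fun m _ z hz => ?_
  have h := eqOn_iteratedDerivWithin hS h0 hG m
  exact (hG m z hz).differentiableWithinAt.congr h (h hz)

/-! ### Exponential series on strips -/

/-- The exponential `e^{ikLz}`. -/
noncomputable def wave (L : ℝ) (k : ℤ) (z : ℂ) : ℂ := Complex.exp (Complex.I * k * L * z)

theorem wave_eq_zpow (L : ℝ) (k : ℤ) (z : ℂ) :
    wave L k z = Complex.exp (Complex.I * L * z) ^ k := by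
  rw [wave, ← Complex.exp_int_mul]
  congr 1
  ring

theorem norm_wave (L : ℝ) (k : ℤ) (z : ℂ) : ‖wave L k z‖ = Real.exp (-(k * L * z.im)) := by
  rw [wave, Complex.norm_exp]
  congr 1
  simp [Complex.mul_re, Complex.mul_im]

theorem hasDerivAt_wave (L : ℝ) (k : ℤ) (z : ℂ) :
    HasDerivAt (wave L k) (Complex.I * k * L * wave L k z) z := by
  have := ((hasDerivAt_id z).const_mul (Complex.I * k * L)).cexp
  unfold wave
  simpa [mul_comm] using this

theorem continuous_wave (L : ℝ) (k : ℤ) : Continuous (wave L k) := by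
  unfold wave
  fun_prop

theorem convex_strip (p : ℝ) : Convex ℝ (strip p) := by
  have : strip p = Complex.imLm ⁻¹' Set.Icc (-|delta p|) |delta p| := by
    ext z
    simp [strip, abs_le]
  rw [this]
  exact (convex_Icc _ _).linear_preimage _

/-- The growth rate `e^{L|δ_p|}` of the exponentials on the strip `S_p`. -/
noncomputable def stripRate (L p : ℝ) : ℝ := Real.exp (L * |delta p|)

theorem one_le_stripRate {L : ℝ} (hL : 0 ≤ L) (p : ℝ) : 1 ≤ stripRate L p :=
  Real.one_le_exp (by positivity)

theorem norm_wave_le {L p : ℝ} (hL : 0 ≤ L) (k : ℤ) {z : ℂ} (hz : z ∈ strip p) :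
    ‖wave L k z‖ ≤ stripRate L p ^ k.natAbs := by
  rw [norm_wave, stripRate, ← Real.exp_nat_mul]
  refine Real.exp_le_exp.2 ?_
  have h1 : |z.im| ≤ |delta p| := hz
  calc -(k * L * z.im) ≤ |(k : ℝ) * L * z.im| := neg_le_abs _
    _ = |(k : ℝ)| * L * |z.im| := by rw [abs_mul, abs_mul, abs_of_nonneg hL]
    _ ≤ |(k : ℝ)| * L * |delta p| := by gcongr
    _ = _ := by
      rw [Nat.cast_natAbs, Int.cast_abs]
      ring

/-- The `m`-th derivative of the series `∑ a_k e^{ikLz}`. -/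
noncomputable def waveSeries (L : ℝ) (a : ℤ → ℂ) (m : ℕ) (z : ℂ) : ℂ :=
  ∑' k : ℤ, a k * (Complex.I * k * L) ^ m * wave L k z

/-- All the series of derivatives converge absolutely on the strip `S_p`. -/
def RapidDecay (L p : ℝ) (a : ℤ → ℂ) : Prop :=
  ∀ m : ℕ, Summable fun k : ℤ => (1 + (k.natAbs : ℝ)) ^ m * stripRate L p ^ k.natAbs * ‖a k‖

theorem norm_waveSeries_term_le {L p : ℝ} (hL : 0 ≤ L) (a : ℤ → ℂ) (m : ℕ) (k : ℤ) {z : ℂ}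
    (hz : z ∈ strip p) : ‖a k * (Complex.I * k * L) ^ m * wave L k z‖ ≤
      L ^ m * ((1 + (k.natAbs : ℝ)) ^ m * stripRate L p ^ k.natAbs * ‖a k‖) := by
  have hk : ‖(Complex.I * k * L : ℂ)‖ ≤ (1 + (k.natAbs : ℝ)) * L := by
    rw [norm_mul, norm_mul, Complex.norm_I, one_mul, Complex.norm_intCast, Complex.norm_real,
      Real.norm_of_nonneg hL, Nat.cast_natAbs, Int.cast_abs]
    gcongr
    linarith
  rw [norm_mul, norm_mul, norm_pow]
  calc ‖a k‖ * ‖(Complex.I * k * L : ℂ)‖ ^ m * ‖wave L k z‖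
      ≤ ‖a k‖ * ((1 + (k.natAbs : ℝ)) * L) ^ m * stripRate L p ^ k.natAbs := by
        gcongr
        exact norm_wave_le hL k hz
    _ = _ := by
      rw [mul_pow]
      ring

theorem RapidDecay.summable {L p : ℝ} (hL : 0 ≤ L) {a : ℤ → ℂ} (ha : RapidDecay L p a) (m : ℕ)
    {z : ℂ} (hz : z ∈ strip p) :
    Summable fun k : ℤ => a k * (Complex.I * k * L) ^ m * wave L k z :=
  Summable.of_norm_bounded ((ha m).mul_left _) fun k => norm_waveSeries_term_le hL a m k hz

theorem RapidDecay.hasDerivWithinAt {L p : ℝ} (hL : 0 ≤ L) {a : ℤ → ℂ} (ha : RapidDecay L p a)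
    (m : ℕ) {z : ℂ} (hz : z ∈ strip p) :
    HasDerivWithinAt (waveSeries L a m) (waveSeries L a (m + 1) z) (strip p) z := by
  have hd : ∀ (m : ℕ) (k : ℤ) (z : ℂ), HasDerivWithinAt
      (fun z => a k * (Complex.I * k * L) ^ m * wave L k z)
      (a k * (Complex.I * k * L) ^ (m + 1) * wave L k z) (strip p) z := by
    intro m k z
    have := ((hasDerivAt_wave L k z).const_mul (a k * (Complex.I * k * L) ^ m)).hasDerivWithinAt
      (s := strip p)
    convert! this using 1
    ring
  -- The criterion needs a summable bound for the second derivatives of the terms of order `m`,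
  -- hence decay of order `m + 2`.
  exact hasDerivWithinAt_tsum_of_convex (convex_strip p) ((ha (m + 2)).mul_left (L ^ (m + 2)))
    (fun k z _ => hd m k z) (fun k z _ => hd (m + 1) k z)
    (fun k z hz => norm_waveSeries_term_le hL a (m + 2) k hz)
    (fun z hz => ha.summable hL m hz) (fun z hz => ha.summable hL (m + 1) hz) hz

/-! ### Weighted bounds -/

/-- A convergent sum controlling the constants below. -/
noncomputable def decayConst : ℝ := ∑' k : ℤ, 1 / (1 + (k.natAbs : ℝ)) ^ 2

theorem summable_decay_nat : Summable fun n : ℕ => 1 / (1 + (n : ℝ)) ^ 2 := by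
  have := (summable_nat_add_iff 1).2 (Real.summable_one_div_nat_pow.2 one_lt_two)
  refine this.congr fun n => ?_
  push_cast
  ring

theorem summable_decay_int : Summable fun k : ℤ => 1 / (1 + (k.natAbs : ℝ)) ^ 2 :=
  Summable.of_nat_of_neg (by simpa using summable_decay_nat) (by simpa using summable_decay_nat)

theorem decayConst_nonneg : 0 ≤ decayConst := tsum_nonneg fun _ => by positivity

theorem tsum_decay_nat_le : ∑' n : ℕ, 1 / (1 + (n : ℝ)) ^ 2 ≤ decayConst := by
  have h := tsum_comp_le_tsum_of_inj summable_decay_int (fun _ => by positivity)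
    (Nat.cast_injective (R := ℤ))
  simpa [Function.comp_def, decayConst] using h

/-- Two powers of `1 + n` are traded for a summable factor. Such trades produce the index shifts by
2 in the seminorm estimates. -/
theorem term_le_of_bound {r x M : ℝ} {m n : ℕ}
    (h : (1 + (n : ℝ)) ^ (m + 2) * r ^ n * x ≤ M) :
    (1 + (n : ℝ)) ^ m * r ^ n * x ≤ M * (1 / (1 + (n : ℝ)) ^ 2) := by
  rw [mul_one_div, le_div_iff₀ (by positivity)]
  calc _ = (1 + (n : ℝ)) ^ (m + 2) * r ^ n * x := by ring
    _ ≤ M := h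

theorem rapidDecay_of_bound {L p : ℝ} {A : ℕ → ℂ}
    (hA : ∀ m : ℕ, ∃ M, ∀ n : ℕ, (1 + (n : ℝ)) ^ m * stripRate L p ^ n * ‖A n‖ ≤ M) :
    RapidDecay L p fun k => A k.natAbs := by
  intro m
  obtain ⟨M, hM⟩ := hA (m + 2)
  refine Summable.of_nonneg_of_le (fun k => ?_) (fun k => term_le_of_bound (hM k.natAbs))
    (summable_decay_int.mul_left M)
  have : 0 < stripRate L p := Real.exp_pos _
  positivity

theorem norm_waveSeries_le {L p : ℝ} (hL : 0 ≤ L) {A : ℕ → ℂ} {m : ℕ} {M : ℝ}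
    (hM : ∀ n : ℕ, (1 + (n : ℝ)) ^ (m + 2) * stripRate L p ^ n * ‖A n‖ ≤ M) {z : ℂ}
    (hz : z ∈ strip p) :
    ‖waveSeries L (fun k => A k.natAbs) m z‖ ≤ L ^ m * decayConst * M := by
  refine (tsum_of_norm_bounded ((summable_decay_int.mul_left (L ^ m * M)).hasSum)
    fun k => ?_).trans (le_of_eq ?_)
  · refine (norm_waveSeries_term_le hL (fun k => A k.natAbs) m k hz).trans ?_
    rw [mul_assoc (L ^ m)]
    exact mul_le_mul_of_nonneg_left (term_le_of_bound (hM k.natAbs)) (by positivity)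
  · rw [tsum_mul_left, decayConst]
    ring

theorem hasSum_symPow {L p : ℝ} (hL : 0 ≤ L) {A : ℕ → ℂ}
    (hA : RapidDecay L p fun k => A k.natAbs) {z : ℂ} (hz : z ∈ strip p) :
    HasSum (fun n : ℕ => A n * symPow (Complex.exp (Complex.I * L * z)) n)
      (waveSeries L (fun k => A k.natAbs) 0 z) := by
  have h := (hA.summable hL 0 hz).hasSum.nat_add_neg
  -- Pairing `k` with `-k` counts `k = 0` twice; removing one copy matches `symPow w 0 = 1`.
  have h2 := h.sub (hasSum_ite_eq 0 (A 0))
  have h3 : waveSeries L (fun k => A k.natAbs) 0 z = (∑' k : ℤ, A k.natAbs *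
      (Complex.I * k * L) ^ 0 * wave L k z) + A (0 : ℤ).natAbs * (Complex.I * (0 : ℤ) * L) ^ 0 *
        wave L 0 z - A 0 := by
    simp [waveSeries, wave]
  rw [h3]
  refine h2.congr_fun fun n => ?_
  rcases eq_or_ne n 0 with rfl | hn
  · simp [symPow, wave]
  · simp [symPow, hn, wave_eq_zpow, mul_add]

theorem waveSeries_neg (L : ℝ) (A : ℕ → ℂ) (z : ℂ) :
    waveSeries L (fun k => A k.natAbs) 0 (-z) = waveSeries L (fun k => A k.natAbs) 0 z := by
  unfold waveSeries
  rw [← (Equiv.neg ℤ).tsum_eq]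
  refine tsum_congr fun k => ?_
  simp [wave]

theorem wave_add_period {L : ℝ} (hL : L ≠ 0) (k : ℤ) (z : ℂ) :
    wave L k (z + (2 * Real.pi / L : ℝ)) = wave L k z := by
  have hL' : (L : ℂ) ≠ 0 := by exact_mod_cast hL
  rw [wave, wave, Complex.exp_eq_exp_iff_exists_int]
  refine ⟨k, ?_⟩
  push_cast
  field_simp

/-! ### Fourier coefficients of periodic functions on strips -/

theorem line_mem_strip {p s : ℝ} (hs : |s| ≤ |delta p|) (x : ℝ) :
    (x + s * Complex.I : ℂ) ∈ strip p := by
  simpa [strip] using hs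

theorem mem_interior_strip {p : ℝ} {z : ℂ} (hz : |z.im| < |delta p|) : z ∈ interior (strip p) := by
  have ho : IsOpen {z : ℂ | |z.im| < |delta p|} :=
    isOpen_lt (Complex.continuous_im.abs) continuous_const
  have hsub : {z : ℂ | |z.im| < |delta p|} ⊆ strip p := by
    intro w hw
    have h : |w.im| < |delta p| := hw
    exact h.le
  exact interior_maximal hsub ho hz

/-- The Fourier coefficient of `f` on the horizontal line at height `s`. -/
noncomputable def lineCoeff (L : ℝ) (f : ℂ → ℂ) (k : ℤ) (s : ℝ) : ℂ :=
  1 / ((2 * Real.pi / L : ℝ) : ℂ) * ∫ x in (0 : ℝ)..(2 * Real.pi / L),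
    wave L (-k) (x + s * Complex.I) * f (x + s * Complex.I)

section

variable {L p : ℝ} {f : ℂ → ℂ}

/-- Cauchy's theorem on the rectangle with corners `0` and `2π/L + is`: by periodicity the two
vertical sides cancel. -/
theorem lineCoeff_eq (hL : 0 < L) (hper : ∀ z ∈ strip p, f (z + (2 * Real.pi / L : ℝ)) = f z)
    (hc : ContinuousOn f (strip p)) (hd : DifferentiableOn ℂ f (interior (strip p))) (k : ℤ)
    {s : ℝ} (hs : |s| ≤ |delta p|) : lineCoeff L f k s = lineCoeff L f k 0 := by
  have him : ∀ {y : ℝ}, y ∈ Set.uIcc 0 s → |y| ≤ |s| := by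
    intro y hy
    simpa using Set.abs_sub_left_of_mem_uIcc hy
  have h := Complex.integral_boundary_rect_eq_zero_of_continuousOn_of_differentiableOn
    (fun z => wave L (-k) z * f z) 0 ((2 * Real.pi / L : ℝ) + s * Complex.I)
    ((continuous_wave L (-k)).continuousOn.mul (hc.mono fun z hz => by
      have := him (by simpa using hz.2 : z.im ∈ Set.uIcc 0 s)
      exact this.trans hs))
    (DifferentiableOn.mul
      (fun z _ => (hasDerivAt_wave L (-k) z).differentiableAt.differentiableWithinAt) (hd.mono fun z hz => by
        refine mem_interior_strip (lt_of_lt_of_le ?_ hs)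
        have h2 : z.im ∈ Set.Ioo (min 0 s) (max 0 s) := by simpa using hz.2
        rcases le_total 0 s with h0 | h0
        · rw [min_eq_left h0, max_eq_right h0] at h2
          rw [abs_of_pos h2.1, abs_of_nonneg h0]
          exact h2.2
        · rw [min_eq_right h0, max_eq_left h0] at h2
          rw [abs_of_neg h2.2, abs_of_nonpos h0]
          linarith [h2.1]))
  simp only [Complex.zero_re, Complex.zero_im, Complex.add_re, Complex.ofReal_re, Complex.mul_re,
    Complex.I_re, mul_zero, Complex.ofReal_im, Complex.I_im, mul_one, sub_self, add_zero,
    Complex.add_im, Complex.mul_im, zero_add, Complex.ofReal_zero, zero_mul] at h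
  have hv : (∫ y in (0 : ℝ)..s, wave L (-k) ((2 * Real.pi / L : ℝ) + y * Complex.I) *
      f ((2 * Real.pi / L : ℝ) + y * Complex.I)) =
      ∫ y in (0 : ℝ)..s, wave L (-k) (y * Complex.I) * f (y * Complex.I) := by
    refine intervalIntegral.integral_congr fun y hy => ?_
    have hmem : (y * Complex.I : ℂ) ∈ strip p := by
      simpa using line_mem_strip ((him hy).trans hs) 0
    rw [add_comm, wave_add_period hL.ne', hper _ hmem]
  rw [hv, add_sub_cancel_right, sub_eq_zero] at h
  rw [lineCoeff, lineCoeff, ← h]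
  simp

theorem hasDerivAt_line (hf : ContDiffOn ℂ ∞ f (strip p)) (m : ℕ) {s : ℝ}
    (hs : |s| ≤ |delta p|) (x : ℝ) :
    HasDerivAt (fun x : ℝ => iteratedDerivWithin m f (strip p) (x + s * Complex.I))
      (iteratedDerivWithin (m + 1) f (strip p) (x + s * Complex.I)) x := by
  have h1 : HasDerivWithinAt (iteratedDerivWithin m f (strip p))
      (iteratedDerivWithin (m + 1) f (strip p) (x + s * Complex.I)) (strip p)
      (x + s * Complex.I) := by
    rw [iteratedDerivWithin_succ]
    exact (hf.differentiableOn_iteratedDerivWithin (by exact_mod_cast WithTop.coe_lt_top m)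
      (uniqueDiffOn_strip p) _ (line_mem_strip hs x)).hasDerivWithinAt
  have h2 : HasDerivAt (fun x : ℝ => (x + s * Complex.I : ℂ)) 1 x :=
    (Complex.ofRealCLM.hasDerivAt (x := x)).add_const _
  have := h1.scomp_hasDerivAt x h2 (fun x => line_mem_strip hs x)
  simpa [Function.comp_def] using this

theorem periodic_line (hf : ContDiffOn ℂ ∞ f (strip p))
    (hper : ∀ z ∈ strip p, f (z + (2 * Real.pi / L : ℝ)) = f z) (m : ℕ) {s : ℝ}
    (hs : |s| ≤ |delta p|) :
    Function.Periodic (fun x : ℝ => iteratedDerivWithin m f (strip p) (x + s * Complex.I))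
      (2 * Real.pi / L) := by
  induction m with
  | zero =>
    intro x
    have := hper _ (line_mem_strip hs x)
    simp only [iteratedDerivWithin_zero]
    rw [← this]
    congr 1
    push_cast
    ring
  | succ m ih =>
    intro x
    have h1 := (hasDerivAt_line hf m hs (x + 2 * Real.pi / L)).comp_add_const x (2 * Real.pi / L)
    exact (h1.congr_of_eventuallyEq (Filter.Eventually.of_forall fun y => (ih y).symm)).unique
      (hasDerivAt_line hf m hs x)

/-- Integration by parts over a full period, where the boundary terms cancel. -/
theorem pow_mul_lineCoeff (hL : 0 < L) (hf : ContDiffOn ℂ ∞ f (strip p))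
    (hper : ∀ z ∈ strip p, f (z + (2 * Real.pi / L : ℝ)) = f z) (m : ℕ) (k : ℤ) {s : ℝ}
    (hs : |s| ≤ |delta p|) : (Complex.I * k * L) ^ m * lineCoeff L f k s =
      lineCoeff L (iteratedDerivWithin m f (strip p)) k s := by
  induction m with
  | zero => simp [lineCoeff]
  | succ m ih =>
    rw [pow_succ', mul_assoc, ih, lineCoeff, lineCoeff, mul_left_comm]
    congr 1
    have hw : ∀ x : ℝ, HasDerivAt (fun x : ℝ => wave L (-k) (x + s * Complex.I))
        (-(Complex.I * k * L) * wave L (-k) (x + s * Complex.I)) x := by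
      intro x
      have h2 : HasDerivAt (fun x : ℝ => (x + s * Complex.I : ℂ)) 1 x :=
        (Complex.ofRealCLM.hasDerivAt (x := x)).add_const _
      have := (hasDerivAt_wave L (-k) (x + s * Complex.I)).scomp x h2
      simpa [Function.comp_def] using this
    have hcw : Continuous fun x : ℝ => wave L (-k) (x + s * Complex.I) :=
      (continuous_wave L (-k)).comp (by fun_prop)
    have hcf : ∀ m, Continuous fun x : ℝ =>
        iteratedDerivWithin m f (strip p) (x + s * Complex.I) := fun m =>
      continuous_iff_continuousAt.2 fun x => (hasDerivAt_line hf m hs x).continuousAt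
    have hp := intervalIntegral.integral_mul_deriv_eq_deriv_mul
      (a := (0 : ℝ)) (b := 2 * Real.pi / L)
      (fun x _ => hw x) (fun x _ => hasDerivAt_line hf m hs x)
      ((hcw.const_mul _).intervalIntegrable _ _) ((hcf (m + 1)).intervalIntegrable _ _)
    have e1 := (periodic_line hf hper m hs) 0
    have e2 : wave L (-k) (((0 + 2 * Real.pi / L : ℝ) : ℂ) + s * Complex.I) =
        wave L (-k) (((0 : ℝ) : ℂ) + s * Complex.I) := by
      rw [← wave_add_period hL.ne' (-k) (((0 : ℝ) : ℂ) + s * Complex.I)]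
      congr 1
      push_cast
      ring
    simp only at e1
    rw [zero_add] at e1 e2
    rw [hp, e1, e2, sub_self, zero_sub, ← intervalIntegral.integral_neg,
      ← intervalIntegral.integral_const_mul]
    refine intervalIntegral.integral_congr fun x _ => ?_
    ring

theorem norm_lineCoeff_le (hL : 0 < L) {C : ℝ} (hC : ∀ z ∈ strip p, ‖f z‖ ≤ C) (k : ℤ) {s : ℝ}
    (hs : |s| ≤ |delta p|) : ‖lineCoeff L f k s‖ ≤ Real.exp (k * L * s) * C := by
  have hT : 0 < 2 * Real.pi / L := by positivity
  have h := intervalIntegral.norm_integral_le_of_norm_le_const (a := (0 : ℝ))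
    (b := 2 * Real.pi / L) (C := Real.exp (k * L * s) * C)
    (f := fun x : ℝ => wave L (-k) (x + s * Complex.I) * f (x + s * Complex.I)) (fun x _ => by
      rw [norm_mul, norm_wave]
      have : -(((-k : ℤ) : ℝ) * L * (x + s * Complex.I : ℂ).im) = k * L * s := by simp
      rw [this]
      gcongr
      exact hC _ (line_mem_strip hs x))
  rw [sub_zero, abs_of_pos hT] at h
  rw [lineCoeff, norm_mul, norm_div, norm_one, Complex.norm_real, Real.norm_of_nonneg hT.le,
    div_mul_eq_mul_div, one_mul, div_le_iff₀ hT]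
  exact h

/-- On the line at height `s` the factor `e^{-ikLz}` has modulus `e^{kLs}`. The line is moved to the
edge where `ks` is smallest, the lower one for `k ≥ 0` and the upper one for `k ≤ 0`, which gains
`r^{-|k|}`; the power of `|k| L` comes from `pow_mul_lineCoeff`. -/
theorem lineCoeff_decay (hL : 0 < L) (hf : ContDiffOn ℂ ∞ f (strip p))
    (hd : DifferentiableOn ℂ f (interior (strip p)))
    (hper : ∀ z ∈ strip p, f (z + (2 * Real.pi / L : ℝ)) = f z) (m : ℕ) {C : ℝ}
    (hC : ∀ z ∈ strip p, ‖iteratedDerivWithin m f (strip p) z‖ ≤ C) (k : ℤ) :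
    (k.natAbs * L) ^ m * stripRate L p ^ k.natAbs * ‖lineCoeff L f k 0‖ ≤ C := by
  have key : ∀ s : ℝ, |s| ≤ |delta p| → k * L * s = -(k.natAbs * (L * |delta p|)) →
      (k.natAbs * L) ^ m * stripRate L p ^ k.natAbs * ‖lineCoeff L f k 0‖ ≤ C := by
    intro s hs hks
    have h := norm_lineCoeff_le hL hC k hs
    rw [← pow_mul_lineCoeff hL hf hper m k hs, norm_mul, norm_pow, hks, Real.exp_neg,
      lineCoeff_eq hL hper hf.continuousOn hd k hs, norm_mul, norm_mul, Complex.norm_I, one_mul,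
      Complex.norm_intCast, Complex.norm_real, Real.norm_of_nonneg hL.le,
      inv_mul_eq_div, le_div_iff₀ (Real.exp_pos _), Real.exp_nat_mul] at h
    rw [Nat.cast_natAbs, Int.cast_abs, stripRate]
    linarith
  have hk : ((k.natAbs : ℕ) : ℝ) = |(k : ℝ)| := by rw [Nat.cast_natAbs, Int.cast_abs]
  rcases le_total 0 k with h | h
  · refine key (-|delta p|) (by simp) ?_
    rw [hk, abs_of_nonneg (a := (k : ℝ)) (by exact_mod_cast h)]
    ring
  · refine key |delta p| (by simp) ?_
    rw [hk, abs_of_nonpos (a := (k : ℝ)) (by exact_mod_cast h)]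
    ring

theorem wave_add (k : ℤ) (z w : ℂ) : wave L k (z + w) = wave L k z * wave L k w := by
  rw [wave, wave, wave, ← Complex.exp_add]
  congr 1
  ring

theorem fourier_eq_wave (hL : 0 < L) (k : ℤ) (x : ℝ) :
    (fourier k (x : AddCircle (2 * Real.pi / L)) : ℂ) = wave L k x := by
  have hL' : (L : ℂ) ≠ 0 := by exact_mod_cast hL.ne'
  have hpi : (Real.pi : ℂ) ≠ 0 := by exact_mod_cast Real.pi_ne_zero
  rw [fourier_coe_apply, wave]
  congr 1
  push_cast
  field_simp

/-- The Fourier series of `x ↦ f (x + is)` is used with `s = Im z`. Its coefficients are those at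
height 0 times `e^{ikL·is}`, by the contour shift, and this factor completes `e^{ikLx}` to
`e^{ikLz}`. -/
theorem hasSum_lineCoeff (hL : 0 < L) (hc : ContinuousOn f (strip p))
    (hd : DifferentiableOn ℂ f (interior (strip p)))
    (hper : ∀ z ∈ strip p, f (z + (2 * Real.pi / L : ℝ)) = f z)
    (hsum : Summable fun k : ℤ => stripRate L p ^ k.natAbs * ‖lineCoeff L f k 0‖) {z : ℂ}
    (hz : z ∈ strip p) : HasSum (fun k : ℤ => lineCoeff L f k 0 * wave L k z) (f z) := by
  have hT : Fact (0 < 2 * Real.pi / L) := ⟨by positivity⟩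
  set s := z.im with hsdef
  have hs : |s| ≤ |delta p| := hz
  have hperiodic : Function.Periodic (fun x : ℝ => f (x + s * Complex.I)) (2 * Real.pi / L) := by
    intro x
    simp only
    rw [← hper _ (line_mem_strip hs x)]
    congr 1
    push_cast
    ring
  have hcont : Continuous fun x : ℝ => f (x + s * Complex.I) :=
    hc.comp_continuous (by fun_prop) (line_mem_strip hs)
  let F : C(AddCircle (2 * Real.pi / L), ℂ) :=
    ⟨hperiodic.lift, continuous_coinduced_dom.mpr hcont⟩
  have hF : ∀ x : ℝ, F x = f (x + s * Complex.I) := fun x => hperiodic.lift_coe x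
  have hcoeff : ∀ k : ℤ, fourierCoeff F k = lineCoeff L f k 0 * wave L k (s * Complex.I) := by
    intro k
    rw [fourierCoeff_eq_intervalIntegral F k 0, ← lineCoeff_eq hL hper hc hd k hs, lineCoeff,
      zero_add, Complex.real_smul, mul_assoc, ← intervalIntegral.integral_mul_const]
    push_cast
    congr 1
    refine intervalIntegral.integral_congr fun x _ => ?_
    have h1 : wave L (-k) (s * Complex.I) * wave L k (s * Complex.I) = 1 := by
      rw [wave, wave, ← Complex.exp_add, Complex.exp_eq_one_iff]
      exact ⟨0, by push_cast; ring⟩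
    simp only [smul_eq_mul]
    rw [fourier_eq_wave hL, hF, wave_add]
    linear_combination (-wave L (-k) x * f (x + s * Complex.I)) * h1
  have hsummable : Summable (fourierCoeff F) := by
    refine Summable.of_norm_bounded hsum fun k => ?_
    rw [hcoeff, norm_mul, mul_comm]
    gcongr
    exact norm_wave_le hL.le k (by simpa using line_mem_strip hs 0)
  have h := has_pointwise_sum_fourier_series_of_summable hsummable (z.re : AddCircle _)
  have hzz : (z.re + s * Complex.I : ℂ) = z := Complex.re_add_im z
  rw [hF, hzz] at h
  refine h.congr_fun fun k => ?_
  rw [smul_eq_mul, hcoeff, fourier_eq_wave hL, mul_assoc, ← wave_add, add_comm, hzz]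

theorem lineCoeff_neg (hL : 0 < L) (heven : ∀ x : ℝ, f (-x) = f x)
    (hper : ∀ x : ℝ, f (x + (2 * Real.pi / L : ℝ)) = f x) (k : ℤ) :
    lineCoeff L f (-k) 0 = lineCoeff L f k 0 := by
  have hp : Function.Periodic (fun x : ℝ => wave L (-k) x * f x) (2 * Real.pi / L) := by
    intro x
    have h1 := wave_add_period hL.ne' (-k) x
    have h2 := hper x
    simp only [Complex.ofReal_add]
    rw [h1, h2]
  -- The reflection `x ↦ -x` moves the period interval to the left of 0; periodicity moves it back.
  have h := hp.intervalIntegral_add_eq (-(2 * Real.pi / L)) 0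
  rw [neg_add_cancel, zero_add] at h
  simp only [lineCoeff, Complex.ofReal_zero, zero_mul, add_zero]
  rw [← h]
  congr 1
  have h3 := intervalIntegral.integral_comp_neg (a := 0) (b := 2 * Real.pi / L)
    (fun x : ℝ => wave L (-k) x * f x)
  rw [neg_zero] at h3
  rw [← h3]
  refine intervalIntegral.integral_congr fun x _ => ?_
  simp [heven, wave]

theorem integral_wave (hL : 0 < L) {k : ℤ} (hk : k ≠ 0) :
    ∫ x in (0 : ℝ)..(2 * Real.pi / L), wave L k x = 0 := by
  have hL' : (L : ℂ) ≠ 0 := by exact_mod_cast hL.ne'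
  have hk' : (k : ℂ) ≠ 0 := by exact_mod_cast hk
  have h0 : Complex.I * k * L ≠ 0 := mul_ne_zero (mul_ne_zero Complex.I_ne_zero hk') hL'
  have h1 := wave_add_period hL.ne' k 0
  simp only [wave] at h1 ⊢
  rw [zero_add] at h1
  rw [integral_exp_mul_complex h0, h1]
  simp

/-- Multiply the series by `e^{-ijLx}` and integrate termwise over a period: by orthogonality only
`a j` survives. -/
theorem eq_zero_of_waveSeries_eq_zero (hL : 0 < L) {a : ℤ → ℂ} (ha : Summable fun k => ‖a k‖)
    (h0 : ∀ x : ℝ, waveSeries L a 0 x = 0) (j : ℤ) : a j = 0 := by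
  have hT : 0 < 2 * Real.pi / L := by positivity
  have hw : ∀ (k : ℤ) (x : ℝ), ‖wave L k x‖ = 1 := fun k x => by simp [norm_wave]
  have hs := intervalIntegral.hasSum_integral_of_dominated_convergence
    (μ := MeasureTheory.volume) (a := 0) (b := 2 * Real.pi / L)
    (F := fun (k : ℤ) (x : ℝ) => a k * wave L (k - j) x) (f := fun _ => 0) (fun k _ => ‖a k‖)
    (fun k => (continuous_const.mul
      ((continuous_wave L (k - j)).comp Complex.continuous_ofReal)).aestronglyMeasurable)
    (fun k => Filter.Eventually.of_forall fun x _ => by rw [norm_mul, hw, mul_one])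
    (Filter.Eventually.of_forall fun x _ => ha) (by simp)
    (Filter.Eventually.of_forall fun x _ => by
      have h1 : Summable fun k : ℤ => a k * wave L k x :=
        Summable.of_norm_bounded ha fun k => by rw [norm_mul, hw, mul_one]
      have h2 := h1.hasSum.mul_left (wave L (-j) x)
      have h3 : ∑' k : ℤ, a k * wave L k x = 0 := by simpa [waveSeries] using h0 x
      rw [h3, mul_zero] at h2
      refine h2.congr_fun fun k => ?_
      have : wave L (k - j) x = wave L (-j) x * wave L k x := by
        rw [wave, wave, wave, ← Complex.exp_add]
        congr 1
        push_cast
        ring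
      rw [this]
      ring)
  have h1 := hasSum_single (f := fun k : ℤ =>
    ∫ x in (0 : ℝ)..(2 * Real.pi / L), a k * wave L (k - j) x) j (fun k hk => by
      rw [intervalIntegral.integral_const_mul, integral_wave hL (sub_ne_zero.2 hk), mul_zero])
  have h2 := h1.unique hs
  have h3 : a j * ((2 * Real.pi / L : ℝ) : ℂ) = 0 := by
    simpa [wave, mul_comm] using h2
  exact (mul_eq_zero.1 h3).resolve_right (by exact_mod_cast hT.ne')

end

/-! ### The Abel transform -/

/-- All the weighted suprema `sup_n (1 + n)^m rⁿ |h(n)|` are finite. -/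
def WeightedBounds (r : ℝ) (h : ℕ → ℂ) : Prop :=
  ∀ m : ℕ, ∃ M, ∀ n : ℕ, (1 + (n : ℝ)) ^ m * r ^ n * ‖h n‖ ≤ M

/-- The operator `h ↦ h(n) + ∑_j c_j h(n + 2 + 2j)`. For suitable coefficients it is the Abel
transform or its inverse. -/
noncomputable def abelSum (c h : ℕ → ℂ) (n : ℕ) : ℂ := h n + ∑' j, c j * h (n + 2 + 2 * j)

section

variable {r : ℝ} {c h : ℕ → ℂ}

/-- Both `1 + n` and `1 + j` are at most `1 + (n + 2 + 2j)`, so a weight of order `m + 2` at the far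
index pays for order `m` in `n` and order 2 in `j`. -/
theorem weighted_tail_le (hr : 1 ≤ r) {m : ℕ} {M : ℝ}
    (hM : ∀ n : ℕ, (1 + (n : ℝ)) ^ (m + 2) * r ^ n * ‖h n‖ ≤ M) (n j : ℕ) :
    (1 + (n : ℝ)) ^ m * r ^ n * ‖h (n + 2 + 2 * j)‖ ≤ M * (1 / (1 + (j : ℝ)) ^ 2) := by
  rw [mul_one_div, le_div_iff₀ (by positivity)]
  refine le_trans ?_ (hM (n + 2 + 2 * j))
  have h0 : 0 ≤ r := by linarith
  have hN : (1 : ℝ) + ((n + 2 + 2 * j : ℕ) : ℝ) = 1 + n + 2 + 2 * j := by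
    push_cast
    ring
  have h1 : (1 + (n : ℝ)) ^ m ≤ (1 + n + 2 + 2 * j) ^ m :=
    pow_le_pow_left₀ (by positivity) (by linarith [(Nat.cast_nonneg j : (0 : ℝ) ≤ j)]) m
  have h2 : (1 + (j : ℝ)) ^ 2 ≤ (1 + n + 2 + 2 * j) ^ 2 :=
    pow_le_pow_left₀ (by positivity) (by
      linarith [(Nat.cast_nonneg j : (0 : ℝ) ≤ j), (Nat.cast_nonneg n : (0 : ℝ) ≤ n)]) 2
  have h3 : r ^ n ≤ r ^ (n + 2 + 2 * j) := pow_le_pow_right₀ hr (by omega)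
  calc (1 + (n : ℝ)) ^ m * r ^ n * ‖h (n + 2 + 2 * j)‖ * (1 + (j : ℝ)) ^ 2
      = (1 + (n : ℝ)) ^ m * (1 + (j : ℝ)) ^ 2 * r ^ n * ‖h (n + 2 + 2 * j)‖ := by ring
    _ ≤ (1 + n + 2 + 2 * j) ^ m * (1 + n + 2 + 2 * j) ^ 2 * r ^ (n + 2 + 2 * j) *
        ‖h (n + 2 + 2 * j)‖ := by gcongr
    _ = _ := by
        rw [hN]
        ring

theorem summable_tail (hr : 1 ≤ r) (hc : ∀ j, ‖c j‖ ≤ 1) (hh : WeightedBounds r h) (n : ℕ) :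
    Summable fun j => c j * h (n + 2 + 2 * j) := by
  obtain ⟨M, hM⟩ := hh 2
  refine Summable.of_norm_bounded (summable_decay_nat.mul_left M) fun j => ?_
  have h1 := weighted_tail_le (m := 0) hr hM n j
  rw [pow_zero, one_mul] at h1
  rw [norm_mul]
  calc ‖c j‖ * ‖h (n + 2 + 2 * j)‖ ≤ 1 * ‖h (n + 2 + 2 * j)‖ := by gcongr; exact hc j
    _ ≤ r ^ n * ‖h (n + 2 + 2 * j)‖ := by gcongr; exact one_le_pow₀ hr
    _ ≤ _ := h1

theorem norm_abelSum_le (hr : 1 ≤ r) (hc : ∀ j, ‖c j‖ ≤ 1) {m : ℕ} {M : ℝ}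
    (hM : ∀ n : ℕ, (1 + (n : ℝ)) ^ (m + 2) * r ^ n * ‖h n‖ ≤ M) (n : ℕ) :
    (1 + (n : ℝ)) ^ m * r ^ n * ‖abelSum c h n‖ ≤ (1 + decayConst) * M := by
  have hr0 : 0 < r := by linarith
  have hM0 : 0 ≤ M := le_trans (by positivity) (hM 0)
  set W := (1 + (n : ℝ)) ^ m * r ^ n with hW
  have hWpos : 0 < W := by positivity
  have h1 : W * ‖h n‖ ≤ M := by
    refine le_trans ?_ (hM n)
    rw [hW]
    gcongr
    · linarith [(Nat.cast_nonneg n : (0 : ℝ) ≤ n)]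
    · omega
  have h2 : ‖∑' j, c j * h (n + 2 + 2 * j)‖ ≤ W⁻¹ * (M * ∑' j : ℕ, 1 / (1 + (j : ℝ)) ^ 2) := by
    refine tsum_of_norm_bounded ((summable_decay_nat.hasSum.mul_left M).mul_left W⁻¹) fun j => ?_
    rw [inv_mul_eq_div, le_div_iff₀ hWpos, norm_mul]
    calc ‖c j‖ * ‖h (n + 2 + 2 * j)‖ * W ≤ 1 * ‖h (n + 2 + 2 * j)‖ * W := by
          gcongr
          exact hc j
      _ = W * ‖h (n + 2 + 2 * j)‖ := by ring
      _ ≤ _ := weighted_tail_le hr hM n j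
  calc W * ‖abelSum c h n‖ ≤ W * (‖h n‖ + W⁻¹ * (M * ∑' j : ℕ, 1 / (1 + (j : ℝ)) ^ 2)) := by
        gcongr
        exact (norm_add_le _ _).trans (by gcongr)
    _ = W * ‖h n‖ + M * ∑' j : ℕ, 1 / (1 + (j : ℝ)) ^ 2 := by
        rw [mul_add, mul_inv_cancel_left₀ hWpos.ne']
    _ ≤ M + M * decayConst := by
        gcongr
        exact tsum_decay_nat_le
    _ = _ := by ring

theorem WeightedBounds.abelSum (hr : 1 ≤ r) (hc : ∀ j, ‖c j‖ ≤ 1) (hh : WeightedBounds r h) :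
    WeightedBounds r (abelSum c h) := by
  intro m
  obtain ⟨M, hM⟩ := hh (m + 2)
  exact ⟨_, norm_abelSum_le hr hc hM⟩

theorem WeightedBounds.sub (hr : 1 ≤ r) {h' : ℕ → ℂ} (hh : WeightedBounds r h)
    (hh' : WeightedBounds r h') : WeightedBounds r (h - h') := by
  intro m
  obtain ⟨M, hM⟩ := hh m
  obtain ⟨M', hM'⟩ := hh' m
  refine ⟨M + M', fun n => ?_⟩
  have hr0 : 0 < r := by linarith
  calc _ ≤ (1 + (n : ℝ)) ^ m * r ^ n * (‖h n‖ + ‖h' n‖) := by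
        gcongr
        exact norm_sub_le _ _
    _ ≤ _ := by
        rw [mul_add]
        exact add_le_add (hM n) (hM' n)

/-- The recurrence gives `‖h n‖ ≤ ‖h (n + 2j)‖` for all `j`, and the right side tends to 0. -/
theorem WeightedBounds.eq_zero (hr : 1 ≤ r) (hh : WeightedBounds r h) {t : ℂ} (ht : ‖t‖ ≤ 1)
    (hrec : ∀ n, h n = t * h (n + 2)) (n : ℕ) : h n = 0 := by
  obtain ⟨M, hM⟩ := hh 2
  have hle : ∀ j, ‖h n‖ ≤ ‖h (n + 2 * j)‖ := by
    intro j
    induction j with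
    | zero => rfl
    | succ j ih =>
      refine ih.trans ?_
      rw [hrec (n + 2 * j), norm_mul]
      exact mul_le_of_le_one_left (norm_nonneg _) ht
  have h1 : ∀ j : ℕ, ‖h n‖ ≤ M * (1 / (1 + (j : ℝ)) ^ 2) := by
    intro j
    refine le_trans ?_ (weighted_tail_le (m := 0) hr hM n j)
    rw [pow_zero, one_mul]
    have h2 := hle (j + 1)
    rw [show n + 2 * (j + 1) = n + 2 + 2 * j by ring] at h2
    exact h2.trans (le_mul_of_one_le_left (norm_nonneg _) (one_le_pow₀ hr))
  have h2 := ge_of_tendsto' (summable_decay_nat.mul_left M).tendsto_atTop_zero h1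
  simpa using h2

/-- With `S` the shift by 2, constant coefficients `1 - t` give formally the operator `(1 - tS) / (1
- S)`, and the coefficients `-(1 - t) t^j` give its inverse `(1 - S) / (1 - tS)`. This lemma and the
next are these identities with denominators cleared. -/
theorem abelSum_const_sub (hr : 1 ≤ r) {t : ℂ} (ht : ‖1 - t‖ ≤ 1) (hh : WeightedBounds r h)
    (n : ℕ) : abelSum (fun _ => 1 - t) h n - abelSum (fun _ => 1 - t) h (n + 2) =
      h n - t * h (n + 2) := by
  have hs := (summable_tail hr (fun _ : ℕ => ht) hh n).tsum_eq_zero_add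
  have e : ∀ j, n + 2 + 2 * (j + 1) = n + 2 + 2 + 2 * j := fun j => by ring
  simp only [e, mul_zero, add_zero] at hs
  rw [abelSum, abelSum, hs]
  ring

theorem abelSum_geom_sub (hr : 1 ≤ r) {t : ℂ} (ht : ‖1 - t‖ ≤ 1) (ht' : ‖t‖ ≤ 1)
    (hh : WeightedBounds r h) (n : ℕ) :
    abelSum (fun j => -(1 - t) * t ^ j) h n - t * abelSum (fun j => -(1 - t) * t ^ j) h (n + 2) =
      h n - h (n + 2) := by
  have hc : ∀ j : ℕ, ‖-(1 - t) * t ^ j‖ ≤ 1 := fun j => by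
    rw [norm_mul, norm_neg, norm_pow]
    exact mul_le_one₀ ht (by positivity) (pow_le_one₀ (norm_nonneg _) ht')
  have hs := (summable_tail hr hc hh n).tsum_eq_zero_add
  have e : ∀ j, n + 2 + 2 * (j + 1) = n + 2 + 2 + 2 * j := fun j => by ring
  have e2 : ∀ j : ℕ, -(1 - t) * t ^ (j + 1) * h (n + 2 + 2 + 2 * j) =
      t * (-(1 - t) * t ^ j * h (n + 2 + 2 + 2 * j)) := fun j => by ring
  simp only [e, e2, mul_zero, add_zero, pow_zero] at hs
  rw [tsum_mul_left] at hs
  rw [abelSum, abelSum, hs]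
  ring

theorem abelSum_abelSum (hr : 1 ≤ r) {t : ℂ} (ht : ‖1 - t‖ ≤ 1) (ht' : ‖t‖ ≤ 1)
    (hh : WeightedBounds r h) :
    abelSum (fun _ => 1 - t) (abelSum (fun j => -(1 - t) * t ^ j) h) = h := by
  have hc : ∀ j : ℕ, ‖-(1 - t) * t ^ j‖ ≤ 1 := fun j => by
    rw [norm_mul, norm_neg, norm_pow]
    exact mul_le_one₀ ht (by positivity) (pow_le_one₀ (norm_nonneg _) ht')
  have h1 := hh.abelSum hr hc
  have h2 := h1.abelSum hr (fun _ : ℕ => ht)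
  funext n
  -- The two shift identities show that the difference of the two sides is invariant under the shift
  -- by 2, so decay forces it to vanish.
  refine sub_eq_zero.1 ((h2.sub hr hh).eq_zero hr (t := 1) (by simp) (fun n => ?_) n)
  have e1 := abelSum_const_sub hr ht h1 n
  have e2 := abelSum_geom_sub hr ht ht' hh n
  simp only [Pi.sub_apply]
  linear_combination e1 + e2

theorem eq_zero_of_abelSum_eq_zero (hr : 1 ≤ r) {t : ℂ} (ht : ‖1 - t‖ ≤ 1) (ht' : ‖t‖ ≤ 1)
    (hh : WeightedBounds r h) (h0 : ∀ n, abelSum (fun _ => 1 - t) h n = 0) (n : ℕ) : h n = 0 := by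
  refine hh.eq_zero hr ht' (fun n => ?_) n
  have := abelSum_const_sub hr ht hh n
  rw [h0, h0] at this
  linear_combination -this

theorem WeightedBounds.summable (hh : WeightedBounds r h) (m : ℕ) (hr : 0 ≤ r) :
    Summable fun n : ℕ => (1 + (n : ℝ)) ^ m * r ^ n * ‖h n‖ := by
  obtain ⟨M, hM⟩ := hh (m + 2)
  exact Summable.of_nonneg_of_le (fun n => by positivity) (fun n => term_le_of_bound (hM n))
    (summable_decay_nat.mul_left M)

end

/-! ### The spherical transform as an exponential series -/

theorem norm_chebShift_le' {w : ℂ} {r : ℝ} (hr : 1 ≤ r) (h1 : ‖w‖ ≤ r) (h2 : ‖w⁻¹‖ ≤ r) (n : ℕ) :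
    ‖chebShift w n‖ ≤ 2 * (1 + n) * r ^ n := by
  have hr0 : 0 ≤ r := by linarith
  rcases n with _ | _ | n
  · simp [chebShift]
  · simp [chebShift]
    positivity
  · refine (norm_chebShift_le hr h1 h2 n).trans ?_
    have h3 : r ^ n ≤ r ^ (n + 2) := pow_le_pow_right₀ hr (by omega)
    have h4 : (n : ℝ) + 1 ≤ 1 + ((n + 2 : ℕ) : ℝ) := by
      push_cast
      linarith
    gcongr

/-- The profile `n ↦ q^{n/2} F(n)`. -/
noncomputable def scaled (q : ℕ) (F : ℕ → ℂ) (n : ℕ) : ℂ := ((Real.sqrt q : ℝ) : ℂ) ^ n * F n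

/-- The Abel transform of the radial function with values `F(n)`. -/
noncomputable def abel (q : ℕ) (F : ℕ → ℂ) : ℕ → ℂ :=
  abelSum (fun _ => 1 - (q : ℂ)⁻¹) (scaled q F)

theorem norm_inv_natCast_le {q : ℕ} (hq : 0 < q) : ‖((q : ℂ))⁻¹‖ ≤ 1 := by
  rw [norm_inv, Complex.norm_natCast]
  exact inv_le_one_of_one_le₀ (by exact_mod_cast hq)

theorem norm_one_sub_inv_le {q : ℕ} (hq : 0 < q) : ‖1 - ((q : ℂ))⁻¹‖ ≤ 1 := by
  have h : (1 - ((q : ℂ))⁻¹) = ((1 - ((q : ℝ))⁻¹ : ℝ) : ℂ) := by push_cast; rfl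
  have h1 : ((q : ℝ))⁻¹ ≤ 1 := inv_le_one_of_one_le₀ (by exact_mod_cast hq)
  have h2 : 0 ≤ ((q : ℝ))⁻¹ := by positivity
  rw [h, Complex.norm_real, Real.norm_of_nonneg (by linarith)]
  linarith

theorem hasSum_sphericalSeq {q : ℕ} (hq : 0 < q) {p : ℝ} {F : ℕ → ℂ}
    (hF : WeightedBounds (stripRate (Real.log q) p) (scaled q F)) {z : ℂ} (hz : z ∈ strip p) :
    (Summable fun n => (sphereCard q n : ℝ) * ‖F n * sphericalSeq q z n‖) ∧
      HasSum (fun n => (sphereCard q n : ℂ) * (F n * sphericalSeq q z n))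
        (waveSeries (Real.log q) (fun k => abel q F k.natAbs) 0 z) := by
  have hL : 0 ≤ Real.log q := Real.log_natCast_nonneg q
  set r := stripRate (Real.log q) p with hrdef
  have hr : 1 ≤ r := one_le_stripRate hL p
  have hr0 : 0 ≤ r := by linarith
  set w := Complex.exp (Complex.I * Real.log q * z) with hw
  have hw1 : ‖w‖ ≤ r := by
    have := norm_wave_le hL 1 hz
    rwa [wave_eq_zpow, zpow_one, Int.natAbs_one, pow_one] at this
  have hw2 : ‖w⁻¹‖ ≤ r := by
    have := norm_wave_le hL (-1) hz
    rwa [wave_eq_zpow, zpow_neg_one, Int.natAbs_neg, Int.natAbs_one, pow_one] at this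
  have hA : WeightedBounds r (abel q F) := hF.abelSum hr fun _ => norm_one_sub_inv_le hq
  have hterm : ∀ n, (sphereCard q n : ℂ) * (F n * sphericalSeq q z n) =
      scaled q F n * chebShift w (n + 2) - (q : ℂ)⁻¹ * scaled q F n * chebShift w n := by
    intro n
    have := sphereCard_mul_sphericalSeq hq z n
    rw [scaled]
    linear_combination F n * this
  have hu := norm_chebShift_le' hr hw1 hw2
  have hsum := hF.summable 1 hr0
  have hsumA := hA.summable 1 hr0
  constructor
  · refine Summable.of_nonneg_of_le (fun n => by positivity) (fun n => ?_) (hsum.mul_left 4)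
    have e : (sphereCard q n : ℝ) * ‖F n * sphericalSeq q z n‖ =
        ‖(sphereCard q n : ℂ) * (F n * sphericalSeq q z n)‖ := by
      rw [norm_mul (sphereCard q n : ℂ), Complex.norm_natCast]
    rw [e, hterm]
    calc _ ≤ ‖scaled q F n‖ * (2 * (n + 1) * r ^ n) +
          1 * ‖scaled q F n‖ * (2 * (1 + n) * r ^ n) := by
          refine (norm_sub_le _ _).trans ?_
          rw [norm_mul, norm_mul, norm_mul]
          gcongr
          · exact norm_chebShift_le hr hw1 hw2 n
          · exact norm_inv_natCast_le hq
          · exact hu n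
      _ = _ := by ring
  · have hser := hasSum_symPow hL (rapidDecay_of_bound hA) hz
    -- The boundary term of the summation by parts: the contribution of the `n`-th sphere equals
    -- `abel q F n * symPow w n + R (n + 2) - R n`.
    let R : ℕ → ℂ := fun n => ((q : ℂ)⁻¹ * scaled q F n - abel q F n) * chebShift w n
    have hR : Summable R := by
      refine Summable.of_norm_bounded ((hsum.add hsumA).mul_left 2) fun n => ?_
      calc ‖R n‖ ≤ (1 * ‖scaled q F n‖ + ‖abel q F n‖) * (2 * (1 + n) * r ^ n) := by
            simp only [R]
            rw [norm_mul]
            gcongr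
            · refine (norm_sub_le _ _).trans ?_
              rw [norm_mul]
              gcongr
              exact norm_inv_natCast_le hq
            · exact hu n
        _ = _ := by ring
    -- The telescoping sum is `-(R 0 + R 1)`, which vanishes because `chebShift` is 0 at 0 and 1.
    have htel : HasSum (fun n => R (n + 2) - R n) 0 := by
      have h1 := (hasSum_nat_add_iff' 2).2 hR.hasSum
      have h2 := h1.sub hR.hasSum
      simpa [Finset.sum_range_succ, R, chebShift] using h2
    have h3 := hser.add htel
    rw [add_zero] at h3
    refine h3.congr_fun fun n => ?_
    have hrec := abelSum_const_sub hr (norm_one_sub_inv_le hq) hF n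
    change abel q F n - abel q F (n + 2) = _ at hrec
    rw [hterm]
    simp only [R]
    rw [show chebShift w (n + 2) = chebShift w n + symPow w n from rfl]
    linear_combination (-chebShift w n - symPow w n) * hrec

/-! ### The spherical transform between the Schwartz space and the holomorphic functions -/

theorem log_pos_of_two_le {q : ℕ} (hq : 2 ≤ q) : 0 < Real.log q :=
  Real.log_pos (by exact_mod_cast hq)

/-- This is `q^{1/p} = q^{δ_p} q^{1/2}`, where `δ_p ≥ 0` because `p ≤ 2`. The weight of the Schwartz
space thus involves exactly the rate that bounds the exponentials on the strip. -/
theorem weighted_eq (G : SimpleGraph V) (o : V) {q : ℕ} (hq : 0 < q) {p : ℝ} (hp1 : 1 < p)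
    (hp2 : p ≤ 2) (m : ℕ) (f : V → ℂ) (x : V) :
    weighted G o q p m f x = (1 + (G.dist o x : ℝ)) ^ m *
      stripRate (Real.log q) p ^ G.dist o x *
        ‖((Real.sqrt q : ℝ) : ℂ) ^ G.dist o x * f x‖ := by
  have hq0 : (0 : ℝ) < q := by exact_mod_cast hq
  have hp0 : 0 < p := by linarith
  have hd : 0 ≤ delta p := by
    rw [delta, sub_nonneg]
    exact one_div_le_one_div_of_le hp0 hp2
  have hrs : stripRate (Real.log q) p * Real.sqrt q = (q : ℝ) ^ (1 / p) := by
    rw [stripRate, abs_of_nonneg hd, ← Real.rpow_def_of_pos hq0, Real.sqrt_eq_rpow,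
      ← Real.rpow_add hq0, delta]
    congr 1
    ring
  have hpow : (q : ℝ) ^ ((G.dist o x : ℝ) / p) =
      stripRate (Real.log q) p ^ G.dist o x * Real.sqrt q ^ G.dist o x := by
    rw [← mul_pow, hrs, ← Real.rpow_mul_natCast hq0.le]
    congr 1
    ring
  rw [weighted, hpow, norm_mul, norm_pow, Complex.norm_real,
    Real.norm_of_nonneg (Real.sqrt_nonneg _)]
  ring

/-- The values of a radial function on the spheres around `o`. -/
noncomputable def profile (G : SimpleGraph V) (o : V) (f : V → ℂ) (n : ℕ) : ℂ :=
  open Classical in if h : ∃ x, G.dist o x = n then f h.choose else 0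

theorem profile_dist {G : SimpleGraph V} {o : V} {f : V → ℂ} (hf : IsRadial G o f) (x : V) :
    profile G o f (G.dist o x) = f x := by
  have h : ∃ y, G.dist o y = G.dist o x := ⟨x, rfl⟩
  rw [profile, dif_pos h]
  exact hf _ _ h.choose_spec

theorem RadialSchwartz.isRadial {G : SimpleGraph V} {o : V} {q : ℕ} {p : ℝ}
    (f : RadialSchwartz G o q p) : IsRadial G o f.toFun := f.2.2

theorem withSeminorms_radialSchwartz (G : SimpleGraph V) (o : V) (q : ℕ) (p : ℝ) :
    WithSeminorms (RadialSchwartz.seminorm G o q p) := ⟨rfl⟩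

theorem withSeminorms_holStrip (q : ℕ) (p : ℝ) : WithSeminorms (HolStrip.seminorm q p) := ⟨rfl⟩

section

variable {G : SimpleGraph V} [G.LocallyFinite] {q : ℕ} {o : V} {p : ℝ}

theorem weighted_profile_le (hG : G.IsTree) (hq : 0 < q) (hreg : G.IsRegularOfDegree (q + 1))
    (hp1 : 1 < p) (hp2 : p ≤ 2) (f : RadialSchwartz G o q p) (m n : ℕ) :
    (1 + (n : ℝ)) ^ m * stripRate (Real.log q) p ^ n * ‖scaled q (profile G o f.toFun) n‖ ≤
      RadialSchwartz.seminorm G o q p m f := by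
  obtain ⟨x, rfl⟩ := exists_dist_eq hG hq hreg o n
  have h : weighted G o q p m f.toFun x ≤ RadialSchwartz.seminorm G o q p m f :=
    le_ciSup (f.2.1 m) x
  rwa [weighted_eq G o hq hp1 hp2, ← profile_dist f.isRadial x] at h

theorem weightedBounds_profile (hG : G.IsTree) (hq : 0 < q) (hreg : G.IsRegularOfDegree (q + 1))
    (hp1 : 1 < p) (hp2 : p ≤ 2) (f : RadialSchwartz G o q p) :
    WeightedBounds (stripRate (Real.log q) p) (scaled q (profile G o f.toFun)) := fun m =>
  ⟨_, weighted_profile_le hG hq hreg hp1 hp2 f m⟩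

theorem hasSum_sphericalTransform (hG : G.IsTree) (hq : 0 < q)
    (hreg : G.IsRegularOfDegree (q + 1)) {F : ℕ → ℂ}
    (hF : WeightedBounds (stripRate (Real.log q) p) (scaled q F)) {z : ℂ} (hz : z ∈ strip p) :
    HasSum (fun x : V => F (G.dist o x) * spherical G o q z x)
      (waveSeries (Real.log q) (fun k => abel q F k.natAbs) 0 z) :=
  have h := hasSum_sphericalSeq hq hF hz
  hasSum_radial hG hreg o (fun n => F n * sphericalSeq q z n) h.1 h.2

theorem hasSum_mul_spherical (hG : G.IsTree) (hq : 0 < q) (hreg : G.IsRegularOfDegree (q + 1))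
    (hp1 : 1 < p) (hp2 : p ≤ 2) (f : RadialSchwartz G o q p) {z : ℂ} (hz : z ∈ strip p) :
    HasSum (fun x : V => f.toFun x * spherical G o q z x)
      (waveSeries (Real.log q) (fun k => abel q (profile G o f.toFun) k.natAbs) 0 z) := by
  refine (hasSum_sphericalTransform (o := o) hG hq hreg (weightedBounds_profile hG hq hreg hp1 hp2 f)
    hz).congr_fun fun x => ?_
  rw [profile_dist f.isRadial x]

theorem abel_weightedBounds (hq : 0 < q) {F : ℕ → ℂ}
    (hF : WeightedBounds (stripRate (Real.log q) p) (scaled q F)) :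
    WeightedBounds (stripRate (Real.log q) p) (abel q F) :=
  hF.abelSum (one_le_stripRate (Real.log_natCast_nonneg q) p) fun _ => norm_one_sub_inv_le hq

theorem stripDeriv_sphericalTransform (hG : G.IsTree) (hq : 0 < q)
    (hreg : G.IsRegularOfDegree (q + 1)) (hp1 : 1 < p) (hp2 : p ≤ 2) (f : RadialSchwartz G o q p)
    (m : ℕ) (z : strip p) :
    stripDeriv m (fun z : strip p => sphericalTransform G o q f.toFun z) z =
      waveSeries (Real.log q) (fun k => abel q (profile G o f.toFun) k.natAbs) m z := by
  have hF := weightedBounds_profile hG hq hreg hp1 hp2 f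
  refine eqOn_iteratedDerivWithin (uniqueDiffOn_strip p) (fun z hz => ?_)
    (fun m z hz => (rapidDecay_of_bound (abel_weightedBounds hq hF)).hasDerivWithinAt
      (Real.log_natCast_nonneg q) m hz) m z.2
  exact (extend_apply _ ⟨z, hz⟩).trans (hasSum_mul_spherical hG hq hreg hp1 hp2 f hz).tsum_eq

/-- Two of the four extra orders are spent on summing the exponential series and two on the Abel
transform. -/
theorem norm_stripDeriv_sphericalTransform_le (hG : G.IsTree) (hq : 0 < q)
    (hreg : G.IsRegularOfDegree (q + 1)) (hp1 : 1 < p) (hp2 : p ≤ 2) (f : RadialSchwartz G o q p)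
    (m : ℕ) (z : strip p) :
    ‖stripDeriv m (fun z : strip p => sphericalTransform G o q f.toFun z) z‖ ≤
      Real.log q ^ m * decayConst * ((1 + decayConst) *
        RadialSchwartz.seminorm G o q p (m + 2 + 2) f) := by
  have hL := Real.log_natCast_nonneg q
  rw [stripDeriv_sphericalTransform hG hq hreg hp1 hp2]
  exact norm_waveSeries_le hL (norm_abelSum_le (one_le_stripRate hL p)
    (fun _ => norm_one_sub_inv_le hq)
    (weighted_profile_le hG hq hreg hp1 hp2 f (m + 2 + 2))) z.2

theorem isHolStrip_sphericalTransform (hG : G.IsTree) (hq : 2 ≤ q)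
    (hreg : G.IsRegularOfDegree (q + 1)) (hp1 : 1 < p) (hp2 : p ≤ 2)
    (f : RadialSchwartz G o q p) :
    IsHolStrip q p fun z : strip p => sphericalTransform G o q f.toFun z := by
  have hq0 : 0 < q := by omega
  have hL := log_pos_of_two_le hq
  have hF := weightedBounds_profile hG hq0 hreg hp1 hp2 f
  have hval : ∀ z : strip p, sphericalTransform G o q f.toFun z =
      waveSeries (Real.log q) (fun k => abel q (profile G o f.toFun) k.natAbs) 0 z := fun z =>
    (hasSum_mul_spherical hG hq0 hreg hp1 hp2 f z.2).tsum_eq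
  have hsmooth : ContDiffOn ℂ ∞
      (extend fun z : strip p => sphericalTransform G o q f.toFun z) (strip p) :=
    contDiffOn_of_hasDerivWithinAt (uniqueDiffOn_strip p)
      (fun z hz => (extend_apply _ ⟨z, hz⟩).trans (hval ⟨z, hz⟩))
      (fun m z hz => (rapidDecay_of_bound (abel_weightedBounds hq0 hF)).hasDerivWithinAt
        hL.le m hz)
  refine ⟨fun z w h => ?_, fun z w h => ?_, ?_, ?_, hsmooth, fun m => ?_⟩
  · rw [hval, hval, h, waveSeries_neg]
  · rw [hval, hval, h]
    unfold waveSeries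
    refine tsum_congr fun k => ?_
    rw [tau, wave_add_period hL.ne']
  · exact (hsmooth.differentiableOn (by simp)).mono interior_subset
  · have := continuousOn_iff_continuous_domRestrict.1 hsmooth.continuousOn
    exact this.congr fun z => extend_apply _ z
  · exact ⟨_, Set.forall_mem_range.2
      (norm_stripDeriv_sphericalTransform_le hG hq0 hreg hp1 hp2 f m)⟩

/-- The spherical Fourier transform as a linear map. -/
noncomputable def sphericalTransformLinear (hG : G.IsTree) (hq : 2 ≤ q)
    (hreg : G.IsRegularOfDegree (q + 1)) (hp1 : 1 < p) (hp2 : p ≤ 2) :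
    RadialSchwartz G o q p →ₗ[ℂ] HolStrip q p where
  toFun f := ⟨fun z => sphericalTransform G o q f.toFun z,
    isHolStrip_sphericalTransform hG hq hreg hp1 hp2 f⟩
  map_add' f g := Subtype.ext <| funext fun z => by
    have hs := fun f : RadialSchwartz G o q p =>
      (hasSum_mul_spherical hG (by omega) hreg hp1 hp2 f z.2).summable
    refine Eq.trans ?_ ((hs f).tsum_add (hs g))
    exact tsum_congr fun x => add_mul _ _ _
  map_smul' c f := Subtype.ext <| funext fun z => by
    refine Eq.trans ?_ (tsum_mul_left (a := c))
    exact tsum_congr fun x => mul_assoc _ _ _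

/-! ### Injectivity, and preimages with seminorm bounds -/

theorem sphericalTransform_injective (hG : G.IsTree) (hq : 2 ≤ q)
    (hreg : G.IsRegularOfDegree (q + 1)) (hp1 : 1 < p) (hp2 : p ≤ 2)
    (f : RadialSchwartz G o q p)
    (h0 : ∀ z : strip p, sphericalTransform G o q f.toFun z = 0) : f = 0 := by
  have hq0 : 0 < q := by omega
  have hL := log_pos_of_two_le hq
  have hr := one_le_stripRate hL.le p
  have hF := weightedBounds_profile hG hq0 hreg hp1 hp2 f
  have hA := rapidDecay_of_bound (abel_weightedBounds hq0 hF)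
  have hsum : Summable fun k : ℤ => ‖abel q (profile G o f.toFun) k.natAbs‖ :=
    (hA 0).of_nonneg_of_le (fun _ => norm_nonneg _) fun k => by
      rw [pow_zero, one_mul]
      exact le_mul_of_one_le_left (norm_nonneg _) (one_le_pow₀ hr)
  have hzero := eq_zero_of_waveSeries_eq_zero hL hsum fun x => by
    have hx : (x : ℂ) ∈ strip p := by simp [strip]
    rw [← (hasSum_mul_spherical hG hq0 hreg hp1 hp2 f hx).tsum_eq]
    exact h0 ⟨x, hx⟩
  have hscaled := eq_zero_of_abelSum_eq_zero hr (norm_one_sub_inv_le hq0)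
    (norm_inv_natCast_le hq0) hF fun n => hzero n
  refine Subtype.ext <| funext fun x => ?_
  have h := hscaled (G.dist o x)
  rw [scaled, profile_dist f.isRadial x] at h
  refine (mul_eq_zero.1 h).resolve_left (pow_ne_zero _ ?_)
  exact_mod_cast (Real.sqrt_pos.2 (by exact_mod_cast hq0 : (0 : ℝ) < q)).ne'

/-- The decay of Fourier coefficients comes with the weight `(nL)^m`, which says nothing at `n = 0`
for `m ≥ 1`. The unweighted bound `C₀` fills the gap, through `(1 + n)^m ≤ 2^m (1 + n^m)`. -/
theorem one_add_pow_mul_le {L r x C₀ C : ℝ} (hL : 0 < L) (hr : 0 ≤ r) (hx : 0 ≤ x) (m n : ℕ)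
    (h0 : r ^ n * x ≤ C₀) (hm : (n * L) ^ m * r ^ n * x ≤ C) :
    (1 + (n : ℝ)) ^ m * r ^ n * x ≤ 2 ^ m * (C₀ + (L ^ m)⁻¹ * C) := by
  have hLm : 0 < L ^ m := by positivity
  have h1 : (n : ℝ) ^ m * r ^ n * x ≤ (L ^ m)⁻¹ * C := by
    rw [inv_mul_eq_div, le_div_iff₀ hLm]
    calc _ = (n * L) ^ m * r ^ n * x := by ring
      _ ≤ C := hm
  have h2 : (1 + (n : ℝ)) ^ m ≤ 2 ^ m * (1 + (n : ℝ) ^ m) := by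
    rcases Nat.eq_zero_or_pos n with rfl | hn
    · have : (1 : ℝ) ≤ 2 ^ m := one_le_pow₀ one_le_two
      have h3 : (0 : ℝ) ≤ 2 ^ m * ((0 : ℕ) : ℝ) ^ m := by positivity
      rw [Nat.cast_zero, add_zero, one_pow, mul_add]
      simp only [Nat.cast_zero] at h3
      linarith
    · have hn' : (1 : ℝ) ≤ n := by exact_mod_cast hn
      calc (1 + (n : ℝ)) ^ m ≤ (2 * n) ^ m := by
            gcongr
            linarith
        _ = 2 ^ m * (n : ℝ) ^ m := mul_pow _ _ _
        _ ≤ _ := by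
            gcongr
            linarith
  calc _ ≤ 2 ^ m * (1 + (n : ℝ) ^ m) * r ^ n * x := by gcongr
    _ = 2 ^ m * (r ^ n * x + (n : ℝ) ^ m * r ^ n * x) := by ring
    _ ≤ _ := by gcongr

/-- The preimage is explicit: take the Fourier coefficients of `g`, invert the Abel transform and
divide by `q^{n/2}`. The accompanying bound yields continuity of the inverse without an open mapping
argument. -/
theorem exists_sphericalTransform_eq (hG : G.IsTree) (hq : 2 ≤ q)
    (hreg : G.IsRegularOfDegree (q + 1)) (hp1 : 1 < p) (hp2 : p ≤ 2) (g : HolStrip q p) :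
    ∃ f : RadialSchwartz G o q p,
      (∀ z : strip p, sphericalTransform G o q f.toFun z = g.toFun z) ∧
      ∀ m, RadialSchwartz.seminorm G o q p m f ≤ (1 + decayConst) * (2 ^ (m + 2) *
        (HolStrip.seminorm q p 0 g +
          (Real.log q ^ (m + 2))⁻¹ * HolStrip.seminorm q p (m + 2) g)) := by
  have hq0 : 0 < q := by omega
  have hL := log_pos_of_two_le hq
  have hr := one_le_stripRate hL.le p
  have hr0 : 0 ≤ stripRate (Real.log q) p := by linarith
  have hs0 : ((Real.sqrt q : ℝ) : ℂ) ≠ 0 := by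
    exact_mod_cast (Real.sqrt_pos.2 (by exact_mod_cast hq0 : (0 : ℝ) < q)).ne'
  have hg : IsHolStrip q p g.toFun := g.2
  set f₀ := extend g.toFun with hf₀
  have hval : ∀ z : strip p, f₀ z = g.toFun z := extend_apply _
  have hper : ∀ z ∈ strip p, f₀ (z + (2 * Real.pi / Real.log q : ℝ)) = f₀ z := by
    intro z hz
    have hz' : z + (2 * Real.pi / Real.log q : ℝ) ∈ strip p := by
      simpa only [strip, Set.mem_ofPred_eq, Complex.add_im, Complex.ofReal_im, add_zero] using hz
    exact (hval ⟨_, hz'⟩).trans ((hg.periodic ⟨z, hz⟩ ⟨_, hz'⟩ rfl).trans (hval ⟨z, hz⟩).symm)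
  have hreal : ∀ x : ℝ, (x : ℂ) ∈ strip p := fun x => by simp [strip]
  have heven : ∀ x : ℝ, f₀ (-x) = f₀ x := by
    intro x
    have hx : (-x : ℂ) ∈ strip p := by simp [strip]
    exact (hval ⟨_, hx⟩).trans ((hg.even ⟨x, hreal x⟩ ⟨_, hx⟩ rfl).trans (hval ⟨x, hreal x⟩).symm)
  have hC : ∀ m, ∀ z ∈ strip p,
      ‖iteratedDerivWithin m f₀ (strip p) z‖ ≤ HolStrip.seminorm q p m g := fun m z hz =>
    le_ciSup (hg.bounded m) ⟨z, hz⟩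
  let A : ℕ → ℂ := fun n => lineCoeff (Real.log q) f₀ n 0
  -- Evenness of `g` makes the coefficients depend on `|k|` only, as the coefficients of a spherical
  -- transform must.
  have hA : ∀ k : ℤ, A k.natAbs = lineCoeff (Real.log q) f₀ k 0 := by
    intro k
    rcases Int.natAbs_eq k with h | h
    · simp only [A]
      rw [← h]
    · have := lineCoeff_neg hL heven (fun x => hper x (hreal x)) (k.natAbs : ℤ)
      simp only [A]
      rw [← this, ← h]
  have hdecay : ∀ m n : ℕ, (1 + (n : ℝ)) ^ m * stripRate (Real.log q) p ^ n * ‖A n‖ ≤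
      2 ^ m * (HolStrip.seminorm q p 0 g +
        (Real.log q ^ m)⁻¹ * HolStrip.seminorm q p m g) := by
    intro m n
    have h := fun m => lineCoeff_decay hL hg.smooth hg.holomorphic hper m (hC m) n
    simp only [Int.natAbs_natCast] at h
    refine one_add_pow_mul_le hL hr0 (norm_nonneg _) m n ?_ (h m)
    have h0 := h 0
    rwa [pow_zero, one_mul] at h0
  have hAb : WeightedBounds (stripRate (Real.log q) p) A := fun m => ⟨_, hdecay m⟩
  set t : ℂ := (q : ℂ)⁻¹ with ht
  have ht1 : ‖1 - t‖ ≤ 1 := norm_one_sub_inv_le hq0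
  have ht2 : ‖t‖ ≤ 1 := norm_inv_natCast_le hq0
  have hc : ∀ j : ℕ, ‖-(1 - t) * t ^ j‖ ≤ 1 := fun j => by
    rw [norm_mul, norm_neg, norm_pow]
    exact mul_le_one₀ ht1 (by positivity) (pow_le_one₀ (norm_nonneg _) ht2)
  -- The inverse Abel transform of `A`, which costs two more orders of decay.
  let h := abelSum (fun j => -(1 - t) * t ^ j) A
  have hh := fun m => norm_abelSum_le (m := m) hr hc (hdecay (m + 2))
  let F : ℕ → ℂ := fun n => h n / ((Real.sqrt q : ℝ) : ℂ) ^ n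
  have hscaled : scaled q F = h := by
    funext n
    exact mul_div_cancel₀ _ (pow_ne_zero n hs0)
  have habel : abel q F = A := by
    rw [abel, hscaled]
    exact abelSum_abelSum hr ht1 ht2 hAb
  have hF : WeightedBounds (stripRate (Real.log q) p) (scaled q F) := by
    rw [hscaled]
    exact hAb.abelSum hr hc
  have hweight : ∀ m x, weighted G o q p m (fun x => F (G.dist o x)) x ≤
      (1 + decayConst) * (2 ^ (m + 2) * (HolStrip.seminorm q p 0 g +
        (Real.log q ^ (m + 2))⁻¹ * HolStrip.seminorm q p (m + 2) g)) := by
    intro m x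
    rw [weighted_eq G o hq0 hp1 hp2]
    have e : ((Real.sqrt q : ℝ) : ℂ) ^ G.dist o x * F (G.dist o x) = h (G.dist o x) :=
      congrFun hscaled _
    rw [e]
    exact hh m _
  refine ⟨⟨fun x => F (G.dist o x), fun m => ?_, fun x y hxy => ?_⟩, fun z => ?_, fun m => ?_⟩
  · exact ⟨_, Set.forall_mem_range.2 (hweight m)⟩
  · simp only [hxy]
  · have h1 := hasSum_sphericalTransform (o := o) hG hq0 hreg hF z.2
    refine h1.tsum_eq.trans ?_
    rw [habel, ← hval z]
    refine Eq.trans (tsum_congr fun k => ?_) (hasSum_lineCoeff hL hg.smooth.continuousOn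
      hg.holomorphic hper ((rapidDecay_of_bound hAb 0).congr fun k => ?_) z.2).tsum_eq
    · simp only [hA, pow_zero, mul_one, hf₀]
    · simp only [hA, pow_zero, one_mul, hf₀]
  · have : Nonempty V := ⟨o⟩
    exact ciSup_le (hweight m)

/-! ### Continuity of the transform and of its inverse -/

theorem continuous_sphericalTransformLinear (hG : G.IsTree) (hq : 2 ≤ q)
    (hreg : G.IsRegularOfDegree (q + 1)) (hp1 : 1 < p) (hp2 : p ≤ 2) :
    Continuous (sphericalTransformLinear (o := o) hG hq hreg hp1 hp2) := by
  refine (withSeminorms_radialSchwartz G o q p).continuous_of_isBounded (withSeminorms_holStrip q p) _ fun m => ?_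
  have hK := decayConst_nonneg
  have hL := log_pos_of_two_le hq
  refine ⟨{m + 2 + 2}, ⟨Real.log q ^ m * decayConst * (1 + decayConst), by positivity⟩, ?_⟩
  intro f
  rw [Finset.sup_singleton]
  have : Nonempty (strip p) := ⟨⟨0, by simp [strip]⟩⟩
  refine ciSup_le fun z =>
    (norm_stripDeriv_sphericalTransform_le hG (by omega) hreg hp1 hp2 f m z).trans (le_of_eq ?_)
  exact (mul_assoc _ _ _).symm

theorem continuous_symm_sphericalTransform (hG : G.IsTree) (hq : 2 ≤ q)
    (hreg : G.IsRegularOfDegree (q + 1)) (hp1 : 1 < p) (hp2 : p ≤ 2)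
    (e : RadialSchwartz G o q p ≃ₗ[ℂ] HolStrip q p)
    (he : ∀ f, e f = sphericalTransformLinear hG hq hreg hp1 hp2 f) : Continuous e.symm := by
  refine (withSeminorms_holStrip q p).continuous_of_isBounded (withSeminorms_radialSchwartz G o q p)
    e.symm.toLinearMap fun m => ?_
  have hK := decayConst_nonneg
  have hL := log_pos_of_two_le hq
  -- The bound for the preimage involves `μ_0` and `μ_{m+2}`; the constant results from replacing
  -- both by their maximum.
  refine ⟨{0, m + 2}, ⟨(1 + decayConst) * (2 ^ (m + 2) * (1 + (Real.log q ^ (m + 2))⁻¹)),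
    by positivity⟩, ?_⟩
  intro g
  obtain ⟨f, hf, hbound⟩ := exists_sphericalTransform_eq (o := o) hG hq hreg hp1 hp2 g
  have hfg : e.symm g = f := by
    rw [LinearEquiv.symm_apply_eq, he]
    exact Subtype.ext (funext fun z => (hf z).symm)
  have hsup : ∀ i ∈ ({0, m + 2} : Finset ℕ), HolStrip.seminorm q p i g ≤
      (({0, m + 2} : Finset ℕ).sup (HolStrip.seminorm q p)) g := fun i hi =>
    Seminorm.le_finset_sup_apply hi
  have h0 := hsup 0 (by simp)
  have h2 := hsup (m + 2) (by simp)
  rw [Seminorm.comp_apply, LinearEquiv.coe_coe, hfg]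
  refine (hbound m).trans ?_
  change _ ≤ (1 + decayConst) * (2 ^ (m + 2) * (1 + (Real.log q ^ (m + 2))⁻¹)) *
    (({0, m + 2} : Finset ℕ).sup (HolStrip.seminorm q p)) g
  set B := (({0, m + 2} : Finset ℕ).sup (HolStrip.seminorm q p)) g
  calc _ ≤ (1 + decayConst) * (2 ^ (m + 2) * (B + (Real.log q ^ (m + 2))⁻¹ * B)) := by gcongr
    _ = _ := by ring

end

end HomogeneousTree

theorem theorem5p1 {V : Type*} (G : SimpleGraph V) [G.LocallyFinite] (hG : G.IsTree)
    (q : ℕ) (hq : 2 ≤ q) (hreg : G.IsRegularOfDegree (q + 1)) (o : V)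
    (p : ℝ) (hp1 : 1 < p) (hp2 : p ≤ 2) :
    (∀ (f : HomogeneousTree.RadialSchwartz G o q p) (z : HomogeneousTree.strip p),
      Summable fun x : V => f.toFun x * HomogeneousTree.spherical G o q z x) ∧
    ∃ e : HomogeneousTree.RadialSchwartz G o q p ≃L[ℂ] HomogeneousTree.HolStrip q p,
      ∀ (f : HomogeneousTree.RadialSchwartz G o q p) (z : HomogeneousTree.strip p),
        (e f).toFun z = HomogeneousTree.sphericalTransform G o q f.toFun z := by
  refine ⟨fun f z => (HomogeneousTree.hasSum_mul_spherical hG (by omega) hreg hp1 hp2 f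
    z.2).summable, ?_⟩
  let T := HomogeneousTree.sphericalTransformLinear (o := o) hG hq hreg hp1 hp2
  have hinj : Function.Injective T := (injective_iff_map_eq_zero T).2 fun f hf =>
    HomogeneousTree.sphericalTransform_injective hG hq hreg hp1 hp2 f fun z =>
      congrFun (congrArg Subtype.val hf) z
  have hsurj : Function.Surjective T := fun g => by
    obtain ⟨f, hf, -⟩ := HomogeneousTree.exists_sphericalTransform_eq (o := o) hG hq hreg hp1 hp2 g
    exact ⟨f, Subtype.ext (funext hf)⟩
  let e := LinearEquiv.ofBijective T ⟨hinj, hsurj⟩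
  exact ⟨⟨e, HomogeneousTree.continuous_sphericalTransformLinear hG hq hreg hp1 hp2,
    HomogeneousTree.continuous_symm_sphericalTransform hG hq hreg hp1 hp2 e fun _ => rfl⟩,
    fun _ _ => rfl⟩
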